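/- **Theorem (Rips–Čech correspondence).** Let $X$ be a geodesic metric space, i.e. a metric space in which any two points $x,y$ are joined by a path of length $d(x,y)$. For $r>0$ let $\mathrm{Rips}(X,r)$ be the simplicial complex with vertex set $X$ whose simplices are the nonempty finite $\sigma\subset X$ with $\operatorname{diam}\sigma<r$, and let $\check{C}\mathrm{ech}(X,r)$ be the one whose simplices are the nonempty finite $\sigma\subset X$ with $\bigcap_{z\in\sigma}B(z,r)\neq\emptyset$ (open balls). A persistence is a family of groups $\{A_r\}_{r>0}$ with bonding homomorphisms $A_p\to A_q$ for $p<q$; for complexes these are induced by inclusion. An isomorphism of persistences is a family of group isomorphisms commuting with the bonding homomorphisms. For $\bullet\in X$ and real $r$ let $\mathcal L(X,r,\pi_1)\le\pi_1(X,\bullet)$ be the subgroup generated by the classes of the loops $\alpha*\beta*\alpha^-$, where $\alpha$ is a path of finite length from $\bullet$ to some point and $\beta$ is a loop of length less than $r$ based at that point. For an abelian group $G$ let $\mathcal L(X,r,G)\le H_1(X;G)$ (singular homology) be the subgroup generated by the classes $g[\beta]$ with $g\in G$ and $\beta$ a loop of length less than $r$. Put $\mathcal L(X,\mathrm{fin},*)=\bigcup_{n\in\mathbb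 N}\mathcal L(X,n,*)$ for $*=\pi_1$ or $*=G$. (Each $\mathcal L(X,r,\pi_1)$ is a normal subgroup of $\mathcal L(X,\mathrm{fin},\pi_1)$.) Then for every basepoint $\bullet\in X$ there are isomorphisms of persistences $$\{\pi_1(\check{C}\mathrm{ech}(X,3r),\bullet)\}_{r>0}\;\cong\;\{\pi_1(\mathrm{Rips}(X,4r),\bullet)\}_{r>0}\;\cong\;\{\mathcal L(X,\mathrm{fin},\pi_1)/\mathcal L(X,12r,\pi_1)\}_{r>0},$$ and for every abelian group $G$ there are isomorphisms of persistences $$\{H_1(\check{C}\mathrm{ech}(X,3r);G)\}_{r>0}\;\cong\;\{H_1(\mathrm{Rips}(X,4r);G)\}_{r>0}\;\cong\;\{\mathcal L(X,\mathrm{fin},G)/\mathcal L(X,12r,G)\}_{r>0},$$ where the bonding homomorphisms of the last persistence in each line are the natural quotient maps. -/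

import Mathlib

open CategoryTheory

universe u

noncomputable section

namespace RipsCech

/-! ### Geodesic spaces -/

/-- The length of a path: the supremum of the lengths of inscribed polygons. -/
def pathLength {X : Type u} [MetricSpace X] {x y : X} (p : Path x y) : ENNReal :=
  eVariationOn (fun t => p t) Set.univ

/-- Any two points are joined by a path whose length is their distance. -/
def IsGeodesicSpace (X : Type u) [MetricSpace X] : Prop :=
  ∀ x y : X, ∃ p : Path x y, pathLength p = edist x y

/-! ### Positive scales, the open Rips complex and the open Čech complex -/

/-- The ordered set of positive real scales, regarded as a category. -/
abbrev Scale : Type := {r : ℝ // 0 < r}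

/-- The functor `r ↦ c * r` on positive scales. -/
def scaleBy (c : ℝ) (hc : 0 < c) : Scale ⥤ Scale :=
  Monotone.functor (f := fun r : Scale => (⟨c * r.1, mul_pos hc r.2⟩ : Scale))
    (fun r s h => Subtype.mk_le_mk.2 (mul_le_mul_of_nonneg_left (show r.1 ≤ s.1 from h) hc.le))

/-- The open Rips complex: finite nonempty sets of diameter less than `r`. -/
def rips (X : Type u) [MetricSpace X] (r : Scale) : AbstractSimplicialComplex X where
  faces := {s | s.Nonempty ∧ Metric.diam (s : Set X) < r.1}
  isRelLowerSet_faces := fun _ hs =>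
    ⟨hs.1, fun _ ht hne => ⟨hne, (Metric.diam_mono (Finset.coe_subset.2 ht)
      (Finset.finite_toSet _).isBounded).trans_lt hs.2⟩⟩
  singleton_mem := fun v => ⟨Finset.singleton_nonempty v, by simpa using r.2⟩

/-- The open Čech complex: finite nonempty sets whose open `r`-balls have a common point. -/
def cech (X : Type u) [MetricSpace X] (r : Scale) : AbstractSimplicialComplex X where
  faces := {s | s.Nonempty ∧ (⋂ z ∈ s, Metric.ball z r.1).Nonempty}
  isRelLowerSet_faces := fun _ hs =>
    ⟨hs.1, fun _ ht hne => ⟨hne, hs.2.mono (Set.biInter_subset_biInter_left ht)⟩⟩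
  singleton_mem := fun v => ⟨Finset.singleton_nonempty v, ⟨v, by simpa using r.2⟩⟩

theorem rips_mono (X : Type u) [MetricSpace X] : Monotone (rips X) :=
  fun _ _ h _ hs => ⟨hs.1, lt_of_lt_of_le hs.2 h⟩

theorem cech_mono (X : Type u) [MetricSpace X] : Monotone (cech X) :=
  fun _ _ h _ hs =>
    ⟨hs.1, hs.2.mono (Set.iInter₂_mono fun _ _ => Metric.ball_subset_ball h)⟩

/-- The Rips filtration; complexes on the vertex set `X` form a category under inclusion. -/
def ripsFiltration (X : Type u) [MetricSpace X] : Scale ⥤ AbstractSimplicialComplex X :=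
  (rips_mono X).functor

/-- The Čech filtration. -/
def cechFiltration (X : Type u) [MetricSpace X] : Scale ⥤ AbstractSimplicialComplex X :=
  (cech_mono X).functor

/-! ### Geometric realization of a simplicial complex and its fundamental group -/

/-- The closed simplex spanned by the finite set `s`, in barycentric coordinates. As a subspace of
`V → ℝ` it is the usual Euclidean simplex. -/
def closedSimplex {V : Type u} (s : Finset V) : Set (V → ℝ) :=
  {f | (∀ v, 0 ≤ f v) ∧ (∀ v, v ∉ s → f v = 0) ∧ ∑ v ∈ s, f v = 1}

/-- The geometric realization of `K`: the union of the closed simplices of its faces. -/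
structure Realization {V : Type u} (K : AbstractSimplicialComplex V) : Type u where
  weight : V → ℝ
  exists_face : ∃ s ∈ K.faces, weight ∈ closedSimplex s

namespace Realization

variable {V : Type u} {K L : AbstractSimplicialComplex V}

/-- The inclusion of the closed simplex of a face. -/
def ofSimplex (K : AbstractSimplicialComplex V) (s : K.faces) (f : closedSimplex s.1) :
    Realization K :=
  ⟨f.1, s.1, s.2, f.2⟩

/-- The weak topology: a set is open iff its trace on each closed simplex is open. -/
instance : TopologicalSpace (Realization K) :=
  ⨆ s : K.faces, TopologicalSpace.coinduced (ofSimplex K s) inferInstance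

/-- The point of the realization given by a vertex. -/
def vertex (K : AbstractSimplicialComplex V) (v : V) : Realization K :=
  ⟨fun w => Set.indicator {v} (fun _ => (1 : ℝ)) w, {v}, K.singleton_mem v, by
    refine ⟨fun w => Set.indicator_nonneg (fun _ _ => zero_le_one) w, fun w hw => ?_, by simp⟩
    simpa using hw⟩

/-- The inclusion of realizations induced by an inclusion of complexes. -/
def inclusion (h : K ≤ L) : C(Realization K, Realization L) where
  toFun x := ⟨x.weight, x.exists_face.imp fun _ hs => ⟨h hs.1, hs.2⟩⟩
  continuous_toFun := by
    refine continuous_iSup_dom.2 fun s => continuous_coinduced_dom.2 ?_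
    exact continuous_iSup_rng (i := (⟨s.1, h s.2⟩ : L.faces)) continuous_coinduced_rng

end Realization

/-- `K ↦ π₁(|K|, x₀)`, with the homomorphisms induced by inclusions. -/
def piOne {V : Type u} (x₀ : V) : AbstractSimplicialComplex V ⥤ GrpCat.{u} where
  obj K := GrpCat.of (FundamentalGroup (Realization K) (Realization.vertex K x₀))
  map {K L} h := GrpCat.ofHom
    (show FundamentalGroup (Realization K) (Realization.vertex K x₀) →*
        FundamentalGroup (Realization L) (Realization.vertex L x₀) from
      FundamentalGroup.map (Realization.inclusion h.le) (Realization.vertex K x₀))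
  map_id K := by
    ext p
    induction p using Path.Homotopic.Quotient.ind with
    | mk a => rfl
  map_comp f g := by
    ext p
    induction p using Path.Homotopic.Quotient.ind with
    | mk a => rfl

/-! ### First homology with coefficients -/

/-- The ordered simplicial set of a complex: its `n`-simplices are the `(n + 1)`-tuples of vertices
that lie in a common face, and faces (degeneracies) omit (repeat) vertices. Its chain complex is the
ordered simplicial chain complex of `K`. -/
def orderedSimplices {V : Type u} : AbstractSimplicialComplex V ⥤ SSet.{u} where
  obj K :=
    { obj := fun n => {a : Fin (n.unop.len + 1) → V // ∃ s ∈ K.faces, ∀ i, a i ∈ s}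
      map := fun f => ↾fun a =>
        ⟨fun i => a.1 (f.unop.toOrderHom i),
          a.2.imp fun _ hs => ⟨hs.1, fun i => hs.2 _⟩⟩ }
  map h :=
    { app := fun _ => ↾fun a => ⟨a.1, a.2.imp fun _ hs => ⟨h.le hs.1, hs.2⟩⟩ }

/-- `K ↦ H₁(K; G)`, simplicial homology with coefficients in the abelian group `G`. -/
def hOne (V : Type u) (G : Type u) [AddCommGroup G] :
    AbstractSimplicialComplex V ⥤ AddCommGrpCat.{u} :=
  orderedSimplices ⋙ SSet.homologyFunctor (AddCommGrpCat.of G) 1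

/-- `H₁(X; G)`, singular homology with coefficients in `G`. -/
abbrev singularHOne (X : Type u) [TopologicalSpace X] (G : Type u) [AddCommGroup G] :
    AddCommGrpCat.{u} :=
  (TopCat.toSSet.obj (TopCat.of X)).homology (AddCommGrpCat.of G) 1

/-- A path, viewed as a singular 1-simplex. -/
def pathSimplex {X : Type u} [TopologicalSpace X] {x y : X} (p : Path x y) :
    (TopCat.toSSet.obj (TopCat.of X)).Edge
      (TopCat.toSSetObj₀Equiv.symm x) (TopCat.toSSetObj₀Equiv.symm y) :=
  TopCat.toSSetObjEdgeEquiv.symm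
    ((TopCat.pathEquiv (X := TopCat.of X) (x := x) (y := y)).symm p)

theorem ι_loop_d {X : Type u} [TopologicalSpace X] (G : Type u) [AddCommGroup G] {y : X}
    (p : Path y y) :
    (TopCat.toSSet.obj (TopCat.of X)).ιChainComplex (R := AddCommGrpCat.of G)
      (pathSimplex p).edge ≫
        ((TopCat.toSSet.obj (TopCat.of X)).chainComplex (AddCommGrpCat.of G)).d 1 0 = 0 := by
  rw [SSet.ιChainComplex_d, Fin.sum_univ_two, (pathSimplex p).src_eq, (pathSimplex p).tgt_eq]
  simp

/-- `g ↦ g • [p]`: the homology class of the singular cycle `g • p`, for a loop `p`. -/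
def loopClass {X : Type u} [TopologicalSpace X] (G : Type u) [AddCommGroup G] {y : X}
    (p : Path y y) : AddCommGrpCat.of G ⟶ singularHOne X G :=
  HomologicalComplex.liftCycles _
      ((TopCat.toSSet.obj (TopCat.of X)).ιChainComplex (pathSimplex p).edge) 0
      (ChainComplex.next_nat_succ 0) (ι_loop_d G p) ≫
    HomologicalComplex.homologyπ _ 1

/-! ### The groups generated by short loops -/

/-- The class of the lasso `α * β * α⁻¹` in the fundamental group. -/
def lasso {X : Type u} [TopologicalSpace X] {x₀ y : X} (α : Path x₀ y) (β : Path y y) :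
    FundamentalGroup X x₀ :=
  FundamentalGroup.fromPath (Path.Homotopic.Quotient.mk ((α.trans β).trans α.symm))

/-- `L(X, r, π₁)`: generated by the lassos with rectifiable tail and loop of length less than
`r`. -/
def shortPi (X : Type u) [MetricSpace X] (x₀ : X) (r : ℝ) : Subgroup (FundamentalGroup X x₀) :=
  Subgroup.closure {c | ∃ (y : X) (α : Path x₀ y) (β : Path y y),
    pathLength α ≠ ⊤ ∧ pathLength β < ENNReal.ofReal r ∧ c = lasso α β}

/-- `L(X, fin, π₁)`, the union of the increasing sequence of the `L(X, n, π₁)`. -/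
def finPi (X : Type u) [MetricSpace X] (x₀ : X) : Subgroup (FundamentalGroup X x₀) :=
  ⨆ n : ℕ, shortPi X x₀ n

/-- `L(X, r, G)`: generated by the classes `g • [β]` with `β` a loop of length less than `r`. -/
def shortH (X : Type u) [MetricSpace X] (G : Type u) [AddCommGroup G] (r : ℝ) :
    AddSubgroup (singularHOne X G) :=
  AddSubgroup.closure {c | ∃ (y : X) (β : Path y y) (g : G),
    pathLength β < ENNReal.ofReal r ∧ c = (loopClass G β).hom g}

/-- `L(X, fin, G)`, the union of the increasing sequence of the `L(X, n, G)`. -/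
def finH (X : Type u) [MetricSpace X] (G : Type u) [AddCommGroup G] :
    AddSubgroup (singularHOne X G) :=
  ⨆ n : ℕ, shortH X G n

theorem shortPi_mono (X : Type u) [MetricSpace X] (x₀ : X) : Monotone (shortPi X x₀) := by
  intro r s h
  refine Subgroup.closure_mono ?_
  rintro c ⟨y, α, β, hα, hβ, rfl⟩
  exact ⟨y, α, β, hα, hβ.trans_le (ENNReal.ofReal_le_ofReal h), rfl⟩

theorem shortH_mono (X : Type u) [MetricSpace X] (G : Type u) [AddCommGroup G] :
    Monotone (shortH X G) := by
  intro r s h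
  refine AddSubgroup.closure_mono ?_
  rintro c ⟨y, β, g, hβ, rfl⟩
  exact ⟨y, β, g, hβ.trans_le (ENNReal.ofReal_le_ofReal h), rfl⟩

/-! ### The quotient persistences -/

theorem pathLength_symm {X : Type u} [MetricSpace X] {x y : X} (p : Path x y) :
    pathLength p.symm ≤ pathLength p :=
  eVariationOn.comp_le_of_antitoneOn (fun t => p t) unitInterval.symm
    (fun _ _ _ _ h => unitInterval.symm_le_symm.2 h) (Set.mapsTo_univ _ _)

theorem pathLength_trans_ne_top {X : Type u} [MetricSpace X] {x y z : X} {p : Path x y}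
    {q : Path y z} (hp : pathLength p ≠ ⊤) (hq : pathLength q ≠ ⊤) :
    pathLength (p.trans q) ≠ ⊤ := by
  let h : unitInterval := ⟨1 / 2, by norm_num, by norm_num⟩
  have hl : eVariationOn (fun t => (p.trans q) t) (Set.Iic h) ≤ pathLength p := by
    have : Set.EqOn (fun t => (p.trans q) t)
        ((fun t => p t) ∘ fun t : unitInterval => Set.projIcc 0 1 zero_le_one (2 * (t : ℝ)))
        (Set.Iic h) := by
      intro t ht
      have ht' : (t : ℝ) ≤ 1 / 2 := ht
      simp only [Path.trans_apply, dif_pos ht', Function.comp]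
      congr 1
      exact (Set.projIcc_of_mem zero_le_one _).symm
    rw [eVariationOn.eq_of_eqOn this]
    exact eVariationOn.comp_le_of_monotoneOn _ _
      (fun a _ b _ hab => Set.monotone_projIcc _ (by
        have : (a : ℝ) ≤ b := hab
        linarith)) (Set.mapsTo_univ _ _)
  have hr : eVariationOn (fun t => (p.trans q) t) (Set.Ici h) ≤ pathLength q := by
    have : Set.EqOn (fun t => (p.trans q) t)
        ((fun t => q t) ∘ fun t : unitInterval => Set.projIcc 0 1 zero_le_one (2 * (t : ℝ) - 1))
        (Set.Ici h) := by
      intro t ht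
      have ht' : 1 / 2 ≤ (t : ℝ) := ht
      simp only [Function.comp]
      rcases ht'.eq_or_lt with he | hlt
      · have : t = h := Subtype.ext he.symm
        subst this
        simp [h, Path.trans_apply]
      · simp only [Path.trans_apply, dif_neg (not_le.2 hlt)]
        congr 1
        exact (Set.projIcc_of_mem zero_le_one _).symm
    rw [eVariationOn.eq_of_eqOn this]
    exact eVariationOn.comp_le_of_monotoneOn _ _
      (fun a _ b _ hab => Set.monotone_projIcc _ (by
        have : (a : ℝ) ≤ b := hab
        linarith)) (Set.mapsTo_univ _ _)
  rw [pathLength, ← Set.Iic_union_Ici (a := h), eVariationOn.union _ isGreatest_Iic isLeast_Ici]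
  exact ENNReal.add_ne_top.2 ⟨ne_top_of_le_ne_top hp hl, ne_top_of_le_ne_top hq hr⟩

/-- The classes of rectifiable loops. -/
def rectifiablePi (X : Type u) [MetricSpace X] (x₀ : X) : Subgroup (FundamentalGroup X x₀) where
  carrier := {c | ∃ p : Path x₀ x₀, pathLength p ≠ ⊤ ∧
    c = FundamentalGroup.fromPath (Path.Homotopic.Quotient.mk p)}
  one_mem' := by
    refine ⟨Path.refl x₀, ?_, rfl⟩
    simp [pathLength, eVariationOn]
  mul_mem' := by
    rintro _ _ ⟨p, hp, rfl⟩ ⟨q, hq, rfl⟩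
    exact ⟨q.trans p, pathLength_trans_ne_top hq hp, rfl⟩
  inv_mem' := by
    rintro _ ⟨p, hp, rfl⟩
    exact ⟨p.symm, ne_top_of_le_ne_top hp (pathLength_symm p), rfl⟩

theorem finPi_le_rectifiablePi (X : Type u) [MetricSpace X] (x₀ : X) :
    finPi X x₀ ≤ rectifiablePi X x₀ := by
  refine iSup_le fun n => (Subgroup.closure_le _).2 ?_
  rintro _ ⟨y, α, β, hα, hβ, rfl⟩
  exact ⟨(α.trans β).trans α.symm, pathLength_trans_ne_top
    (pathLength_trans_ne_top hα hβ.ne_top) (ne_top_of_le_ne_top hα (pathLength_symm α)), rfl⟩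

theorem rectifiablePi_le_normalizer (X : Type u) [MetricSpace X] (x₀ : X) (r : ℝ) :
    rectifiablePi X x₀ ≤ Subgroup.normalizer (shortPi X x₀ r : Set (FundamentalGroup X x₀)) := by
  refine Subgroup.le_normalizer_closure_iff.2 ?_
  rintro _ ⟨p, hp, rfl⟩ _ ⟨y, α, β, hα, hβ, rfl⟩
  refine Subgroup.subset_closure ⟨y, p.symm.trans α, β,
    pathLength_trans_ne_top (ne_top_of_le_ne_top hp (pathLength_symm p)) hα, hβ, ?_⟩
  simp only [lasso, Path.trans_symm, Path.symm_symm, FundamentalGroup.mul_def,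
    FundamentalGroup.inv_def, Path.Homotopic.Quotient.mk_trans, Path.Homotopic.Quotient.mk_symm,
    Path.Homotopic.Quotient.trans_assoc]

instance shortPi_normal (X : Type u) [MetricSpace X] (x₀ : X) (r : ℝ) :
    ((shortPi X x₀ r).subgroupOf (finPi X x₀)).Normal :=
  ⟨fun k hk g => Subgroup.le_normalizer_iff.1
    ((finPi_le_rectifiablePi X x₀).trans (rectifiablePi_le_normalizer X x₀ r)) g.1 g.2 k.1 hk⟩

/-- `r ↦ A / N r` with the quotient maps, for an increasing family of normal subgroups. -/
def quotientFunctor {A : Type u} [Group A] (N : Scale → Subgroup A) [∀ r, (N r).Normal]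
    (hN : Monotone N) : Scale ⥤ GrpCat.{u} where
  obj r := GrpCat.of (A ⧸ N r)
  map {r s} h := GrpCat.ofHom (QuotientGroup.map (N r) (N s) (MonoidHom.id A) (hN h.le))
  map_id r := by
    ext c
    rfl
  map_comp f g := by
    ext c
    rfl

/-- `r ↦ A / N r` with the quotient maps, for an increasing family of subgroups of an abelian
group. -/
def quotientAddFunctor {A : Type u} [AddCommGroup A] (N : Scale → AddSubgroup A)
    (hN : Monotone N) : Scale ⥤ AddCommGrpCat.{u} where
  obj r := AddCommGrpCat.of (A ⧸ N r)
  map {r s} h :=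
    AddCommGrpCat.ofHom (QuotientAddGroup.map (N r) (N s) (AddMonoidHom.id A) (hN h.le))
  map_id r := by
    ext c
    rfl
  map_comp f g := by
    ext c
    rfl

/-- The persistence `r ↦ L(X, fin, π₁) / L(X, r, π₁)`. -/
def quotientPi (X : Type u) [MetricSpace X] (x₀ : X) : Scale ⥤ GrpCat.{u} :=
  quotientFunctor (fun r => (shortPi X x₀ r.1).subgroupOf (finPi X x₀))
    (fun _ _ h _ hc => shortPi_mono X x₀ h hc)

/-- The persistence `r ↦ L(X, fin, G) / L(X, r, G)`. -/
def quotientH (X : Type u) [MetricSpace X] (G : Type u) [AddCommGroup G] :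
    Scale ⥤ AddCommGrpCat.{u} :=
  quotientAddFunctor (fun r => (shortH X G r.1).addSubgroupOf (finH X G))
    (fun _ _ h _ hc => shortH_mono X G h hc)

end RipsCech

end

open RipsCech

/-!
A cocycle on a complex `K` with vertices in `X` assigns a group element `e v w` to each edge, with
`e v w * e u v = e u w` on triangles. It is a system of locally constant transition functions both
on the cover of `|K|` by the open stars of vertices and, if `K` contains every finite subset of a
small ball, on the cover of `X` by balls; so it has a holonomy along homotopy classes of paths in
either space. In `X`, classes of geodesics modulo the loops shorter than `L` form such a cocycle as
soon as the geodesic triangles on the simplices of `K` are shorter than `L`: its holonomy in `|K|`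
maps `π₁(K)` to the quotient. Conversely the edges of `K` form a cocycle with values in `π₁(K)`,
whose holonomy in `X` kills the loops shorter than `L`, provided that such a loop splits into at
most three arcs with the following property: any three points of the same arc, and also the three
points of division, span simplices of `K`. The two maps are mutually inverse because a path in `|K|`
is homotopic to a chain of edges, and a path in `X` agrees with a chain of geodesics up to short
loops in `X`. Both conditions hold for `Rips(X, r)` with `L = 3r` and for `Čech(X, r)` with
`L = 4r`, hence `Rips(X, 4r)` and `Čech(X, 3r)` both have `L = 12r`. In homology the same argument
runs on one-dimensional chains modulo boundaries.
-/

namespace RipsCech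

noncomputable section

open unitInterval Topology Simplicial
open Path.Homotopic.Quotient (mk mk_refl mk_symm mk_trans mk_map refl_trans trans_refl trans_symm
  symm_trans trans_assoc)
open RipsCech.Realization (ofSimplex vertex inclusion)

/-! ### Induction along paths -/

section PathInduction

variable {Y : Type*} [TopologicalSpace Y]

theorem unitInterval_rel_of_local {Q : I → I → Prop}
    (htrans : ∀ a b c, a ≤ b → b ≤ c → Q a b → Q b c → Q a c)
    (hloc : ∀ t, ∃ N ∈ 𝓝 t, ∀ a b, a ≤ b → Set.Icc a b ⊆ N → Q a b) : Q 0 1 := by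
  choose N hN hQ using hloc
  obtain ⟨t, t0, tmono, ⟨n, hn⟩, hsub⟩ := exists_monotone_Icc_subset_open_cover_unitInterval
    (fun s => isOpen_interior (s := N s))
    (fun s _ => Set.mem_iUnion.2 ⟨s, mem_interior_iff_mem_nhds.2 (hN s)⟩)
  have hstep : ∀ k, Q (t k) (t (k + 1)) := fun k => by
    obtain ⟨i, hi⟩ := hsub k
    exact hQ i _ _ (tmono k.le_succ) (hi.trans interior_subset)
  have hfirst : ∀ k, Q (t 0) (t (k + 1)) := fun k => by
    induction k with
    | zero => exact hstep 0
    | succ k ih => exact htrans _ _ _ (tmono (k + 1).zero_le) (tmono (k + 1).le_succ) ih (hstep _)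
  simpa only [t0, hn (n + 1) n.le_succ] using hfirst n

theorem mk_subpath_trans {y z : Y} (γ : Path y z) (a b c : I) :
    (mk (γ.subpath a b)).trans (mk (γ.subpath b c)) = mk (γ.subpath a c) :=
  Path.Homotopic.Quotient.eq.2 ⟨Path.Homotopy.subpathTransSubpath γ a b c⟩

theorem subpath_induction {P : ∀ {y z : Y}, Path.Homotopic.Quotient y z → Prop} {y z : Y}
    (γ : Path y z)
    (trans : ∀ a b c, a ≤ b → b ≤ c → P (mk (γ.subpath a b)) → P (mk (γ.subpath b c)) →
      P ((mk (γ.subpath a b)).trans (mk (γ.subpath b c))))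
    (loc : ∀ t, ∃ N ∈ 𝓝 t, ∀ a b, a ≤ b → Set.Icc a b ⊆ N → P (mk (γ.subpath a b))) :
    P (mk γ) := by
  have of_cast : ∀ {y' z' : Y} (hy : y' = y) (hz : z' = z), P ((mk γ).cast hy hz) → P (mk γ) := by
    rintro _ _ rfl rfl h
    simpa using h
  have h01 := unitInterval_rel_of_local (Q := fun a b => P (mk (γ.subpath a b)))
    (fun a b c hab hbc h₁ h₂ => mk_subpath_trans γ a b c ▸ trans a b c hab hbc h₁ h₂) loc
  rw [Path.subpath_zero_one] at h01
  exact of_cast γ.source γ.target h01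

theorem range_subpath_subset {y z : Y} (γ : Path y z) {a b : I} (hab : a ≤ b) {s : Set Y}
    (h : Set.Icc a b ⊆ γ ⁻¹' s) : Set.range (γ.subpath a b) ⊆ s := by
  rw [Path.range_subpath_of_le _ _ _ hab]
  exact Set.image_subset_iff.2 h

theorem path_induction_on_open_cover {V : Type*} {U : V → Set Y}
    (hU : ∀ v, IsOpen (U v)) (hcov : ∀ y, ∃ v, y ∈ U v)
    {P : ∀ {y z : Y}, Path.Homotopic.Quotient y z → Prop}
    (base : ∀ (v : V) {y z : Y} (γ : Path y z), Set.range γ ⊆ U v → P (mk γ))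
    (trans : ∀ {x y z : Y} (γ : Path.Homotopic.Quotient x y) (δ : Path.Homotopic.Quotient y z),
      P γ → P δ → P (γ.trans δ))
    {y z : Y} (γ : Path.Homotopic.Quotient y z) : P γ := by
  induction γ using Path.Homotopic.Quotient.ind with
  | mk γ =>
    refine subpath_induction γ (fun a b c _ _ => trans _ _) fun t => ?_
    obtain ⟨v, hv⟩ := hcov (γ t)
    exact ⟨γ ⁻¹' U v, γ.continuous.continuousAt.preimage_mem_nhds ((hU v).mem_nhds hv),
      fun a b hab hsub => base v _ (range_subpath_subset γ hab hsub)⟩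

theorem map_trans {Z : Type*} [TopologicalSpace Z] {x y z : Y} (γ : Path.Homotopic.Quotient x y)
    (δ : Path.Homotopic.Quotient y z) (f : C(Y, Z)) :
    (γ.trans δ).map f = (γ.map f).trans (δ.map f) := by
  rcases γ with ⟨p⟩
  rcases δ with ⟨q⟩
  exact congrArg mk (p.map_trans q f.continuous)

theorem refl_symm (y : Y) :
    (Path.Homotopic.Quotient.refl y).symm = Path.Homotopic.Quotient.refl y := by
  simp only [← mk_refl, ← mk_symm, Path.refl_symm]

end PathInduction

/-! ### Holonomy of a locally constant cocycle -/

/-- A locally constant `H`-valued cocycle on an open cover. The transition elements compose from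
right to left, in accordance with the multiplication of `FundamentalGroup`. -/
structure CoverCocycle (V Y H : Type*) [TopologicalSpace Y] [Group H] where ofPatches ::
  patch : V → Set Y
  isOpen_patch : ∀ v, IsOpen (patch v)
  exists_mem_patch : ∀ y, ∃ v, y ∈ patch v
  transition : V → V → H
  transition_mul : ∀ {u v w y}, y ∈ patch u → y ∈ patch v → y ∈ patch w →
    transition v w * transition u v = transition u w

namespace CoverCocycle

variable {V Y H : Type*} [TopologicalSpace Y] [Group H] (c : CoverCocycle V Y H)

theorem transition_self {v : V} {y : Y} (h : y ∈ c.patch v) : c.transition v v = 1 := by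
  simpa using c.transition_mul h h h

theorem transition_mul_swap {v w : V} {y : Y} (hv : y ∈ c.patch v) (hw : y ∈ c.patch w) :
    c.transition w v * c.transition v w = 1 := by
  rw [c.transition_mul hv hw hv, c.transition_self hv]

/-- A choice of a patch through each point. -/
def index (y : Y) : V := (c.exists_mem_patch y).choose

theorem mem_patch_index (y : Y) : y ∈ c.patch (c.index y) := (c.exists_mem_patch y).choose_spec

section Transport

variable [TopologicalSpace H] [DiscreteTopology H]

/-- The bundle with discrete fibre `H` glued from the cocycle. -/
@[simps]
def core : FiberBundleCore V Y H where
  baseSet := c.patch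
  isOpen_baseSet := c.isOpen_patch
  indexAt := c.index
  mem_baseSet_at := c.mem_patch_index
  coordChange u v _ h := c.transition u v * h
  coordChange_self u y hy h := by simp [c.transition_self hy]
  continuousOn_coordChange u v :=
    ((continuous_of_discreteTopology (f := fun h : H => c.transition u v * h)).comp
      continuous_snd).continuousOn
  coordChange_comp u v w y hy h := by
    rw [← mul_assoc, c.transition_mul hy.1.1 hy.1.2 hy.2]

theorem isCoveringMap_proj : IsCoveringMap c.core.proj :=
  FiberBundle.isCoveringMap (F := H) (E := c.core.Fiber)

/-- Parallel transport in the covering glued from the cocycle, where the fibre over `y` is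
identified with `H` by means of the patch `c.index y`. -/
def transport {y z : Y} (γ : Path.Homotopic.Quotient y z) (h : H) : H :=
  (c.isCoveringMap_proj.monodromy γ ⟨⟨y, h⟩, rfl⟩).1.2

theorem monodromy_eq {y z : Y} (γ : Path.Homotopic.Quotient y z) (h : H) :
    c.isCoveringMap_proj.monodromy γ ⟨⟨y, h⟩, rfl⟩ = ⟨⟨z, c.transport γ h⟩, rfl⟩ := by
  have key : ∀ q : c.core.proj ⁻¹' {z}, q = ⟨⟨z, q.1.2⟩, rfl⟩ := by
    rintro ⟨⟨a, b⟩, rfl⟩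
    rfl
  exact key _

theorem transport_trans {x y z : Y} (γ : Path.Homotopic.Quotient x y)
    (δ : Path.Homotopic.Quotient y z) (h : H) :
    c.transport (γ.trans δ) h = c.transport δ (c.transport γ h) := by
  rw [transport, c.isCoveringMap_proj.monodromy_trans_apply, monodromy_eq]
  rfl

theorem transport_of_range_subset {u : V} {y z : Y} (γ : Path y z)
    (hγ : Set.range γ ⊆ c.patch u) (k : H) :
    c.transport (mk γ) (c.transition u (c.index y) * k) = c.transition u (c.index z) * k := by
  let sheet (x : Y) : c.core.TotalSpace := ⟨x, c.transition u (c.index x) * k⟩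
  have hsheet : ContinuousOn sheet (c.patch u) :=
    (c.core.localTriv u).toOpenPartialHomeomorph.symm.continuousOn.comp
      (f := fun x => (x, k)) (by fun_prop) fun x hx => (c.core.mem_localTriv_target u _).2 hx
  have hlift : c.isCoveringMap_proj.monodromy (mk γ) ⟨sheet y, rfl⟩ = ⟨sheet z, rfl⟩ :=
    c.isCoveringMap_proj.monodromy_eq_of_map_eq (mk (γ.map' (hsheet.mono hγ))) rfl
  exact congrArg (fun q => q.1.2) hlift

theorem transport_mul {y z : Y} (γ : Path.Homotopic.Quotient y z) (h k : H) :
    c.transport γ (h * k) = c.transport γ h * k := by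
  refine path_induction_on_open_cover c.isOpen_patch c.exists_mem_patch
    (P := fun γ => ∀ h, c.transport γ (h * k) = c.transport γ h * k) ?_ ?_ γ h
  · intro u y z γ hγ h
    have hy : y ∈ c.patch u := hγ ⟨0, γ.source⟩
    have hh : h = c.transition u (c.index y) * (c.transition (c.index y) u * h) := by
      rw [← mul_assoc, c.transition_mul_swap (c.mem_patch_index y) hy, one_mul]
    rw [hh, mul_assoc, c.transport_of_range_subset γ hγ, c.transport_of_range_subset γ hγ]
    simp only [mul_assoc]
  · intro x y z γ δ hγ hδ h
    rw [transport_trans, transport_trans, hγ, hδ]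

end Transport

/-- The holonomy of a path, from the sheet of the patch `v` to the sheet of the patch `w`. It is
meaningful when the patches contain the start and the end of the path. -/
def hol {y z : Y} (v w : V) (γ : Path.Homotopic.Quotient y z) : H :=
  letI : TopologicalSpace H := ⊥
  haveI : DiscreteTopology H := ⟨rfl⟩
  c.transition (c.index z) w * c.transport γ (c.transition v (c.index y))

theorem hol_of_range_subset (u : V) {v w : V} {y z : Y} (γ : Path y z)
    (hγ : Set.range γ ⊆ c.patch u) (hy : y ∈ c.patch v) (hz : z ∈ c.patch w) :
    c.hol v w (mk γ) = c.transition u w * c.transition v u := by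
  let _ : TopologicalSpace H := ⊥
  have : DiscreteTopology H := ⟨rfl⟩
  have hyu : y ∈ c.patch u := hγ ⟨0, γ.source⟩
  have hzu : z ∈ c.patch u := hγ ⟨1, γ.target⟩
  rw [hol, ← c.transition_mul hy hyu (c.mem_patch_index y), c.transport_of_range_subset γ hγ,
    ← mul_assoc, c.transition_mul hzu (c.mem_patch_index z) hz]

theorem hol_trans {u v w : V} {x y z : Y} (γ : Path.Homotopic.Quotient x y)
    (δ : Path.Homotopic.Quotient y z) (hy : y ∈ c.patch v) :
    c.hol u w (γ.trans δ) = c.hol v w δ * c.hol u v γ := by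
  simp only [hol, transport_trans]
  rw [mul_assoc, ← transport_mul, ← mul_assoc (c.transition v _),
    c.transition_mul_swap (c.mem_patch_index y) hy, one_mul]

theorem hol_refl {v w : V} {y : Y} (hv : y ∈ c.patch v) (hw : y ∈ c.patch w) :
    c.hol v w (Path.Homotopic.Quotient.refl y) = c.transition v w := by
  rw [← mk_refl, c.hol_of_range_subset v _ (by simpa using hv) hv hw, c.transition_self hv, mul_one]

theorem hol_symm {v w : V} {y z : Y} (γ : Path.Homotopic.Quotient y z) (hy : y ∈ c.patch v)
    (hz : z ∈ c.patch w) : c.hol w v γ.symm = (c.hol v w γ)⁻¹ := by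
  rw [eq_inv_iff_mul_eq_one, ← c.hol_trans γ γ.symm hz, trans_symm, c.hol_refl hy hy,
    c.transition_self hy]

theorem hol_map {c : CoverCocycle V Y H} {Y' H' : Type*} [TopologicalSpace Y'] [Group H']
    {c' : CoverCocycle V Y' H'} (f : C(Y, Y')) (q : H →* H') (s : V → H')
    (hf : ∀ v, Set.MapsTo f (c.patch v) (c'.patch v))
    (hq : ∀ v w y, y ∈ c.patch v → y ∈ c.patch w →
      q (c.transition v w) = s w * c'.transition v w * (s v)⁻¹)
    {y z : Y} (γ : Path.Homotopic.Quotient y z) {v w : V} (hy : y ∈ c.patch v)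
    (hz : z ∈ c.patch w) :
    q (c.hol v w γ) = s w * c'.hol v w (γ.map f) * (s v)⁻¹ := by
  refine path_induction_on_open_cover c.isOpen_patch c.exists_mem_patch
    (P := fun {y z} γ => ∀ v w, y ∈ c.patch v → z ∈ c.patch w →
      q (c.hol v w γ) = s w * c'.hol v w (γ.map f) * (s v)⁻¹) ?_ ?_ γ v w hy hz
  · intro u y z γ hγ v w hy hz
    have hyu : y ∈ c.patch u := hγ ⟨0, γ.source⟩
    have hzu : z ∈ c.patch u := hγ ⟨1, γ.target⟩
    have hγ' : Set.range (γ.map f.continuous) ⊆ c'.patch u := by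
      rintro _ ⟨t, rfl⟩
      exact hf u (hγ ⟨t, rfl⟩)
    rw [← mk_map, c.hol_of_range_subset u γ hγ hy hz,
      c'.hol_of_range_subset u _ hγ' (hf v hy) (hf w hz), _root_.map_mul, hq u w z hzu hz,
      hq v u y hy hyu]
    group
  · intro x y z γ δ hγ hδ u w hx hz
    obtain ⟨v, hv⟩ := c.exists_mem_patch y
    rw [c.hol_trans γ δ hv, map_trans, c'.hol_trans _ _ (hf v hv), _root_.map_mul, hγ u v hx hv,
      hδ v w hv hz]
    group

theorem hol_gauge {c : CoverCocycle V Y H} {H' : Type*} [Group H']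
    {c' : CoverCocycle V Y H'} (q : H →* H') (s : V → H') (hsub : ∀ v, c.patch v ⊆ c'.patch v)
    (hq : ∀ v w y, y ∈ c.patch v → y ∈ c.patch w →
      q (c.transition v w) = s w * c'.transition v w * (s v)⁻¹)
    {y z : Y} (γ : Path.Homotopic.Quotient y z) {v w : V} (hy : y ∈ c.patch v)
    (hz : z ∈ c.patch w) :
    q (c.hol v w γ) = s w * c'.hol v w γ * (s v)⁻¹ := by
  have h := hol_map (c' := c') (ContinuousMap.id Y) q s hsub hq γ hy hz
  rcases γ with ⟨p⟩
  exact h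

theorem map_hol {c : CoverCocycle V Y H} {H' : Type*} [Group H']
    {c' : CoverCocycle V Y H'} (q : H →* H') (hsub : ∀ v, c.patch v ⊆ c'.patch v)
    (hq : ∀ v w y, y ∈ c.patch v → y ∈ c.patch w → q (c.transition v w) = c'.transition v w)
    {y z : Y} (γ : Path.Homotopic.Quotient y z) {v w : V} (hy : y ∈ c.patch v)
    (hz : z ∈ c.patch w) : q (c.hol v w γ) = c'.hol v w γ := by
  simpa using hol_gauge q 1 hsub (fun v w y hv hw => by simpa using hq v w y hv hw) γ hy hz

theorem map_hol_of_coboundary {c : CoverCocycle V Y H} {H' : Type*} [Group H'] (q : H →* H')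
    (s : V → H') (hq : ∀ v w y, y ∈ c.patch v → y ∈ c.patch w →
      q (c.transition v w) = s w * (s v)⁻¹)
    {y z : Y} (γ : Path.Homotopic.Quotient y z) {v w : V} (hy : y ∈ c.patch v)
    (hz : z ∈ c.patch w) : q (c.hol v w γ) = s w * (s v)⁻¹ := by
  let constOne : CoverCocycle V Y H' :=
    { patch := c.patch
      isOpen_patch := c.isOpen_patch
      exists_mem_patch := c.exists_mem_patch
      transition := 1
      transition_mul := fun _ _ _ => one_mul 1 }
  have hol_constOne : 1 = constOne.hol v w γ :=
    map_hol (c := constOne) (c' := constOne) 1 (fun _ => subset_rfl) (fun _ _ _ _ _ => rfl) γ hy hz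
  rw [hol_gauge (c' := constOne) q s (fun _ => subset_rfl) (fun v w y hv hw => ?_) γ hy hz,
    ← hol_constOne, mul_one]
  exact (hq v w y hv hw).trans (congrArg (· * (s v)⁻¹) (mul_one (s w)).symm)

/-- Holonomy as a homomorphism on the fundamental group. -/
def holHom {y : Y} {v : V} (hy : y ∈ c.patch v) : FundamentalGroup Y y →* H where
  toFun γ := c.hol v v γ.toPath
  map_one' := (c.hol_refl hy hy).trans (c.transition_self hy)
  map_mul' γ δ := c.hol_trans δ.toPath γ.toPath hy

end CoverCocycle

/-! ### Stars and segments in a realization -/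

section Realization

variable {V : Type u}

/-- The vertices `u`, `v`, `w` lie in a common face. -/
def Spans (K : AbstractSimplicialComplex V) (u v w : V) : Prop :=
  ∃ s ∈ K.faces, u ∈ s ∧ v ∈ s ∧ w ∈ s

theorem convex_closedSimplex (s : Finset V) : Convex ℝ (closedSimplex s) := by
  intro f hf g hg a b ha hb hab
  refine ⟨fun v => ?_, fun v hv => ?_, ?_⟩
  · have := hf.1 v
    have := hg.1 v
    simp only [Pi.add_apply, Pi.smul_apply, smul_eq_mul]
    positivity
  · simp [hf.2.1 v hv, hg.2.1 v hv]
  · simp [Finset.sum_add_distrib, ← Finset.mul_sum, hf.2.2, hg.2.2, hab]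

/-- The straight path between two points of a closed simplex. -/
def simplexSegment {s : Finset V} {f g : V → ℝ} (hf : f ∈ closedSimplex s)
    (hg : g ∈ closedSimplex s) : Path (⟨f, hf⟩ : closedSimplex s) ⟨g, hg⟩ where
  toFun t := ⟨AffineMap.lineMap f g (t : ℝ), (convex_closedSimplex s).lineMap_mem hf hg t.2⟩
  continuous_toFun :=
    Continuous.subtype_mk (AffineMap.lineMap_continuous.comp continuous_subtype_val) _
  source' := by simp
  target' := by simp

variable {K : AbstractSimplicialComplex V}

attribute [ext] Realization

theorem continuous_ofSimplex (s : K.faces) : Continuous (ofSimplex K s) :=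
  continuous_iSup_rng (i := s) continuous_coinduced_rng

theorem isOpen_realization_iff {O : Set (Realization K)} :
    IsOpen O ↔ ∀ s : K.faces, IsOpen (ofSimplex K s ⁻¹' O) := by
  rw [isOpen_iSup_iff]
  exact forall_congr' fun s => isOpen_coinduced

theorem isQuotientMap_ofSimplex :
    IsQuotientMap fun x : Σ s : K.faces, closedSimplex s.1 => ofSimplex K x.1 x.2 := by
  refine (isQuotientMap_iff _).2 ⟨isCoinducing_iff.2 fun O => ?_, fun x => ?_⟩
  · rw [isOpen_realization_iff, isOpen_sigma_iff]
    rfl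
  · obtain ⟨s, hs, hx⟩ := x.exists_face
    exact ⟨⟨⟨s, hs⟩, ⟨x.weight, hx⟩⟩, rfl⟩

/-- The open star of the vertex `v`. -/
def openStar (K : AbstractSimplicialComplex V) (v : V) : Set (Realization K) :=
  {x | 0 < x.weight v}

theorem isOpen_openStar (v : V) : IsOpen (openStar K v) := by
  refine isOpen_realization_iff.2 fun s => ?_
  have : Continuous fun f : closedSimplex s.1 => f.1 v :=
    (continuous_apply v).comp continuous_subtype_val
  exact this.isOpen_preimage _ isOpen_Ioi

theorem exists_mem_openStar (x : Realization K) : ∃ v, x ∈ openStar K v := by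
  obtain ⟨s, -, hx⟩ := x.exists_face
  by_contra! h
  have : ∑ v ∈ s, x.weight v ≤ 0 := Finset.sum_nonpos fun v _ => not_lt.1 (h v)
  linarith [hx.2.2]

theorem mem_of_mem_openStar {x : Realization K} {v : V} {s : Finset V}
    (hs : x.weight ∈ closedSimplex s) (hv : x ∈ openStar K v) : v ∈ s := by
  by_contra h
  exact (hs.2.1 v h).not_gt hv

theorem spans_of_mem_openStar {x : Realization K} {u v w : V} (hu : x ∈ openStar K u)
    (hv : x ∈ openStar K v) (hw : x ∈ openStar K w) : Spans K u v w := by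
  obtain ⟨s, hs, hx⟩ := x.exists_face
  exact ⟨s, hs, mem_of_mem_openStar hx hu, mem_of_mem_openStar hx hv, mem_of_mem_openStar hx hw⟩

theorem vertex_mem_openStar (v : V) : vertex K v ∈ openStar K v := by
  simp [openStar, vertex]

theorem vertex_mem_closedSimplex {s : Finset V} {v : V} (hv : v ∈ s) :
    (vertex K v).weight ∈ closedSimplex s := by
  classical
  refine ⟨fun w => Set.indicator_nonneg (fun _ _ => zero_le_one) w, fun w hw => ?_, ?_⟩
  · have hwv : w ∉ ({v} : Set V) := fun h => hw (Set.mem_singleton_iff.1 h ▸ hv)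
    change Set.indicator {v} (fun _ => (1 : ℝ)) w = 0
    exact Set.indicator_of_notMem hwv _
  · simp only [vertex, Set.indicator_apply, Set.mem_singleton_iff]
    rw [Finset.sum_eq_single_of_mem v hv (fun w _ hw => if_neg hw), if_pos rfl]

/-- The barycentre of a face. -/
def barycenter (s : K.faces) : Realization K :=
  ofSimplex K s ⟨fun v => Set.indicator (s.1 : Set V) (fun _ => (s.1.card : ℝ)⁻¹) v,
    fun v => Set.indicator_nonneg (fun _ _ => by positivity) v,
    fun v hv => Set.indicator_of_notMem hv _, by
      have hcard : (s.1.card : ℝ) ≠ 0 :=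
        Nat.cast_ne_zero.2 (K.isRelLowerSet_faces s.2).1.card_pos.ne'
      rw [Finset.sum_indicator_subset _ subset_rfl]
      simp [hcard]⟩

theorem barycenter_mem_openStar (s : K.faces) {v : V} (hv : v ∈ s.1) :
    barycenter s ∈ openStar K v := by
  have hcard : 0 < s.1.card := Finset.card_pos.2 ⟨v, hv⟩
  simpa [openStar, barycenter, ofSimplex, hv] using hcard

/-- The points `x` and `y` lie in a common closed simplex. -/
def Near (x y : Realization K) : Prop :=
  ∃ s ∈ K.faces, x.weight ∈ closedSimplex s ∧ y.weight ∈ closedSimplex s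

theorem Near.symm {x y : Realization K} (h : Near x y) : Near y x :=
  h.imp fun _ hs => ⟨hs.1, hs.2.2, hs.2.1⟩

theorem near_vertex {x : Realization K} {v : V} (h : x ∈ openStar K v) : Near x (vertex K v) := by
  obtain ⟨s, hs, hx⟩ := x.exists_face
  exact ⟨s, hs, hx, vertex_mem_closedSimplex (mem_of_mem_openStar hx h)⟩

theorem near_vertices {v w : V} (h : Spans K v w w) : Near (vertex K v) (vertex K w) := by
  obtain ⟨s, hs, hv, hw, -⟩ := h
  exact ⟨s, hs, vertex_mem_closedSimplex hv, vertex_mem_closedSimplex hw⟩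

/-- The straight path between two points of a simplex. -/
def linePath {x y : Realization K} (h : Near x y) : Path x y where
  toFun t := ⟨AffineMap.lineMap x.weight y.weight (t : ℝ), h.imp fun s hs =>
    ⟨hs.1, (convex_closedSimplex s).lineMap_mem hs.2.1 hs.2.2 t.2⟩⟩
  continuous_toFun := by
    obtain ⟨s, hs, hx, hy⟩ := h
    exact (continuous_ofSimplex ⟨s, hs⟩).comp (simplexSegment hx hy).continuous
  source' := by ext; simp
  target' := by ext; simp

/-- The class of the straight path between two points of a simplex. -/
def line {x y : Realization K} (h : Near x y) : Path.Homotopic.Quotient x y :=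
  mk (linePath h)

theorem line_self {x : Realization K} (h : Near x x) :
    line h = Path.Homotopic.Quotient.refl x := by
  refine congrArg mk ?_
  ext t
  simp [linePath]

theorem line_symm {x y : Realization K} (h : Near x y) : (line h).symm = line h.symm :=
  congrArg mk <| Path.ext <| funext fun t =>
    Realization.ext <| AffineMap.lineMap_apply_one_sub x.weight y.weight (t : ℝ)

theorem line_trans {s : Finset V} (hs : s ∈ K.faces) {x y z : Realization K}
    (hx : x.weight ∈ closedSimplex s) (hy : y.weight ∈ closedSimplex s)
    (hz : z.weight ∈ closedSimplex s) (hxy : Near x y) (hyz : Near y z) (hxz : Near x z) :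
    (line hxy).trans (line hyz) = line hxz := by
  have : ContractibleSpace (closedSimplex s) :=
    (convex_closedSimplex s).contractibleSpace ⟨_, hx⟩
  have h : (mk (simplexSegment hx hy)).trans (mk (simplexSegment hy hz)) =
    mk (simplexSegment hx hz) := Subsingleton.elim _ _
  have h' := congrArg (fun γ => γ.map ⟨ofSimplex K ⟨s, hs⟩, continuous_ofSimplex _⟩) h
  exact (map_trans _ _ _).symm.trans h'

theorem line_vertices_trans {u v w : V} (h : Spans K u v w) (huv : Near (vertex K u) (vertex K v))
    (hvw : Near (vertex K v) (vertex K w)) (huw : Near (vertex K u) (vertex K w)) :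
    (line huv).trans (line hvw) = line huw := by
  obtain ⟨s, hs, hu, hv, hw⟩ := h
  exact line_trans hs (vertex_mem_closedSimplex hu) (vertex_mem_closedSimplex hv)
    (vertex_mem_closedSimplex hw) _ _ _

theorem line_through_star_trans {v w : V} {x : Realization K} (hv : x ∈ openStar K v)
    (hw : x ∈ openStar K w) : (line (near_vertex hv).symm).trans (line (near_vertex hw)) =
      line (near_vertices (spans_of_mem_openStar hv hw hw)) := by
  obtain ⟨s, hs, hx⟩ := x.exists_face
  exact line_trans hs (vertex_mem_closedSimplex (mem_of_mem_openStar hx hv)) hx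
    (vertex_mem_closedSimplex (mem_of_mem_openStar hx hw)) _ _ _

theorem range_linePath_subset_openStar {v : V} {x y : Realization K} (hx : x ∈ openStar K v)
    (hy : y ∈ openStar K v) (h : Near x y) : Set.range (linePath h) ⊆ openStar K v := by
  rintro _ ⟨t, rfl⟩
  have hmem : AffineMap.lineMap (x.weight v) (y.weight v) (t : ℝ) ∈ Set.Ioi (0 : ℝ) :=
    (convex_Ioi 0).lineMap_mem hx hy t.2
  change (0 : ℝ) < (AffineMap.lineMap x.weight y.weight (t : ℝ)) v
  simpa [AffineMap.lineMap_apply] using hmem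

section Contraction

open Classical in
/-- The straight path from a point of a closed simplex to the vertex `v`, or the constant path at
`v` if `v` does not belong to the simplex. -/
def simplexCone (v : V) (x : Σ s : K.faces, closedSimplex s.1) : C(I, Realization K) :=
  if h : v ∈ x.1.1 then
    (linePath (x := ofSimplex K x.1 x.2)
      ⟨x.1.1, x.1.2, x.2.2, vertex_mem_closedSimplex h⟩).toContinuousMap
  else ContinuousMap.const I (vertex K v)

theorem continuous_simplexCone (v : V) : Continuous (simplexCone (K := K) v) := by
  refine continuous_sigma fun s => ?_
  by_cases hv : v ∈ s.1
  · refine ContinuousMap.continuous_of_continuous_uncurry _ ?_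
    have hcone : Continuous fun p : closedSimplex s.1 × I => ofSimplex K s
        ⟨AffineMap.lineMap p.1.1 (vertex K v).weight (p.2 : ℝ),
          (convex_closedSimplex s.1).lineMap_mem p.1.2 (vertex_mem_closedSimplex hv) p.2.2⟩ := by
      refine (continuous_ofSimplex s).comp (Continuous.subtype_mk ?_ _)
      simp only [AffineMap.lineMap_apply_module]
      fun_prop
    convert! hcone using 2 with p
    simp only [simplexCone, dif_pos hv]
    rfl
  · simpa only [simplexCone, dif_neg hv] using continuous_const

theorem continuous_linePath_near_vertex (v : V) :
    Continuous fun x : openStar K v => (linePath (near_vertex x.2)).toContinuousMap := by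
  refine (isQuotientMap_ofSimplex.restrictPreimage_isOpen (isOpen_openStar v)).continuous_iff.2 ?_
  refine ((continuous_simplexCone v).comp continuous_subtype_val).congr fun x => ?_
  exact dif_pos (mem_of_mem_openStar x.1.2.2 x.2)

/-- The straight contraction of the open star of `v` to `v`. -/
def starContraction (v : V) : (⟨Subtype.val, continuous_subtype_val⟩ :
    C(openStar K v, Realization K)).Homotopy (ContinuousMap.const _ (vertex K v)) where
  toFun p := linePath (near_vertex p.2.2) p.1
  continuous_toFun := by
    let cone : C(openStar K v, C(I, Realization K)) := ⟨_, continuous_linePath_near_vertex v⟩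
    have hcone : Continuous fun p : I × openStar K v => cone p.2 p.1 := by fun_prop
    exact hcone
  map_zero_left x := (linePath (near_vertex x.2)).source
  map_one_left x := (linePath (near_vertex x.2)).target

theorem mk_eq_line_trans_line {v : V} {y z : Realization K} (γ : Path y z)
    (hγ : Set.range γ ⊆ openStar K v) (hy : y ∈ openStar K v) (hz : z ∈ openStar K v) :
    mk γ = (line (near_vertex hy)).trans (line (near_vertex hz).symm) := by
  let γ' : Path (⟨y, hy⟩ : openStar K v) ⟨z, hz⟩ :=
    ⟨⟨fun t => ⟨γ t, hγ ⟨t, rfl⟩⟩, by fun_prop⟩, Subtype.ext γ.source, Subtype.ext γ.target⟩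
  have hsquare : (mk γ).trans (line (near_vertex hz)) =
      (line (near_vertex hy)).trans (Path.Homotopic.Quotient.refl _) :=
    Path.Homotopic.Quotient.eq.2 (Path.Homotopic.map_trans_evalAt (starContraction v) γ')
  rw [← line_symm (near_vertex hz), ← trans_refl (line (near_vertex hy)), ← hsquare, trans_assoc,
    trans_symm, trans_refl]

end Contraction

/-! ### Simplicial cocycles and the fundamental group of a realization -/

/-- An `H`-valued simplicial 1-cocycle on `K`, composed from right to left as in `CoverCocycle`. -/
def IsCocycle {H : Type*} [Group H] (K : AbstractSimplicialComplex V) (e : V → V → H) : Prop :=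
  ∀ u v w, Spans K u v w → e v w * e u v = e u w

section StarCocycle

variable {H : Type*} [Group H] {e : V → V → H}

/-- A simplicial cocycle as a cocycle on the cover of the realization by open stars. -/
@[simps]
def starCocycle (he : IsCocycle K e) : CoverCocycle V (Realization K) H where
  patch := openStar K
  isOpen_patch := isOpen_openStar
  exists_mem_patch := exists_mem_openStar
  transition := e
  transition_mul hu hv hw := he _ _ _ (spans_of_mem_openStar hu hv hw)

theorem hol_line_of_mem_openStar (he : IsCocycle K e) {v : V} {x y : Realization K}
    (hx : x ∈ openStar K v) (hy : y ∈ openStar K v) (h : Near x y) :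
    (starCocycle he).hol v v (line h) = 1 := by
  rw [line, (starCocycle he).hol_of_range_subset v _ (range_linePath_subset_openStar hx hy h) hx hy,
    (starCocycle he).transition_self hx, one_mul]

theorem hol_line (he : IsCocycle K e) {v w : V} (h : Spans K v w w) :
    (starCocycle he).hol v w (line (near_vertices h)) = e v w := by
  obtain ⟨s, hs, hv, hw, -⟩ := id h
  have hbv := barycenter_mem_openStar ⟨s, hs⟩ hv
  have hbw := barycenter_mem_openStar ⟨s, hs⟩ hw
  rw [← line_through_star_trans hbv hbw, (starCocycle he).hol_trans (v := v) _ _ hbv,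
    hol_line_of_mem_openStar he (vertex_mem_openStar v) hbv, mul_one,
    ← refl_trans (line (near_vertex hbw)), (starCocycle he).hol_trans (v := w) _ _ hbw,
    (starCocycle he).hol_refl hbv hbw, hol_line_of_mem_openStar he hbw (vertex_mem_openStar w),
    one_mul, starCocycle_transition]

end StarCocycle

section EdgeLoop

variable {p : Realization K} (θ : ∀ v, Path.Homotopic.Quotient p (vertex K v))

open Classical in
/-- The loop at `p` that runs along the edge from `v` to `w`, with the tails `θ v` and `θ w`;
it is `1` by convention if `v` and `w` do not span a face. -/
def edgeLoop (v w : V) : FundamentalGroup (Realization K) p :=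
  if h : Spans K v w w then
    FundamentalGroup.fromPath (((θ v).trans (line (near_vertices h))).trans (θ w).symm)
  else 1

theorem edgeLoop_of_spans {v w : V} (h : Spans K v w w) : edgeLoop θ v w =
    FundamentalGroup.fromPath (((θ v).trans (line (near_vertices h))).trans (θ w).symm) :=
  dif_pos h

theorem isCocycle_edgeLoop : IsCocycle K (edgeLoop θ) := by
  rintro u v w ⟨s, hs, hu, hv, hw⟩
  rw [edgeLoop_of_spans θ ⟨s, hs, hv, hw, hw⟩, edgeLoop_of_spans θ ⟨s, hs, hu, hv, hv⟩,
    edgeLoop_of_spans θ ⟨s, hs, hu, hw, hw⟩, FundamentalGroup.mul_def,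
    ← line_vertices_trans ⟨s, hs, hu, hv, hw⟩ (near_vertices ⟨s, hs, hu, hv, hv⟩)
      (near_vertices ⟨s, hs, hv, hw, hw⟩)]
  simp only [trans_assoc]
  rw [← trans_assoc (θ v).symm, symm_trans, refl_trans]

theorem hol_edgeLoop {y z : Realization K} (γ : Path.Homotopic.Quotient y z) {v w : V}
    (hy : y ∈ openStar K v) (hz : z ∈ openStar K w) :
    (starCocycle (isCocycle_edgeLoop θ)).hol v w γ = FundamentalGroup.fromPath
      ((((θ v).trans (line (near_vertex hy).symm)).trans γ).trans
        ((line (near_vertex hz)).trans (θ w).symm)) := by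
  set c := starCocycle (isCocycle_edgeLoop θ)
  refine path_induction_on_open_cover (P := fun {y z} γ => ∀ v w (hy : y ∈ openStar K v)
    (hz : z ∈ openStar K w), c.hol v w γ = FundamentalGroup.fromPath
      ((((θ v).trans (line (near_vertex hy).symm)).trans γ).trans
        ((line (near_vertex hz)).trans (θ w).symm)))
    isOpen_openStar exists_mem_openStar ?_ ?_ γ v w hy hz
  · intro u y z γ hγ v w hy hz
    have hyu : y ∈ openStar K u := hγ ⟨0, γ.source⟩
    have hzu : z ∈ openStar K u := hγ ⟨1, γ.target⟩
    rw [c.hol_of_range_subset u γ hγ hy hz, starCocycle_transition, starCocycle_transition,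
      edgeLoop_of_spans θ (spans_of_mem_openStar hzu hz hz),
      edgeLoop_of_spans θ (spans_of_mem_openStar hy hyu hyu), FundamentalGroup.mul_def,
      mk_eq_line_trans_line γ hγ hyu hzu, ← line_through_star_trans hy hyu,
      ← line_through_star_trans hzu hz]
    simp only [trans_assoc]
    rw [← trans_assoc (θ u).symm, symm_trans, refl_trans]
  · intro x y z γ δ hγ hδ v w hx hz
    obtain ⟨u, hu⟩ := exists_mem_openStar y
    rw [c.hol_trans (v := u) γ δ hu, hγ v u hx hu, hδ u w hu hz, FundamentalGroup.mul_def]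
    simp only [trans_assoc]
    rw [← trans_assoc (θ u).symm, symm_trans, refl_trans,
      ← trans_assoc (line (near_vertex hu)), ← line_symm (near_vertex hu), trans_symm, refl_trans]

end EdgeLoop

theorem holHom_edgeLoop {x₀ : V} (θ : ∀ v, Path.Homotopic.Quotient (vertex K x₀) (vertex K v))
    (hθ : θ x₀ = Path.Homotopic.Quotient.refl _) :
    (starCocycle (isCocycle_edgeLoop θ)).holHom (vertex_mem_openStar x₀) = MonoidHom.id _ := by
  ext γ
  refine (hol_edgeLoop θ γ.toPath (vertex_mem_openStar x₀) (vertex_mem_openStar x₀)).trans ?_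
  rw [hθ, line_self, refl_symm, refl_trans, refl_trans, trans_refl]
  rfl

end Realization

/-! ### Lengths of arcs -/

section Arcs

variable {X : Type u} [MetricSpace X] {x y z : X}

/-- The length of the arc of `p` between the parameters `a` and `b`; it is `0` if `b < a`. -/
def arc (p : Path x y) (a b : I) : ENNReal :=
  eVariationOn (fun t => p t) (Set.Icc a b)

theorem arc_mono (p : Path x y) {a b a' b' : I} (ha : a' ≤ a) (hb : b ≤ b') :
    arc p a b ≤ arc p a' b' :=
  eVariationOn.mono _ (Set.Icc_subset_Icc ha hb)

theorem arc_add (p : Path x y) {a b c : I} (hab : a ≤ b) (hbc : b ≤ c) :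
    arc p a b + arc p b c = arc p a c := by
  simpa [arc] using eVariationOn.Icc_add_Icc (fun t => p t) (s := Set.univ) hab hbc (Set.mem_univ b)

theorem arc_self (p : Path x y) (a : I) : arc p a a = 0 :=
  eVariationOn.subsingleton _ (by simp)

theorem arc_zero_one (p : Path x y) : arc p 0 1 = pathLength p :=
  congrArg (eVariationOn _) (Set.eq_univ_of_forall fun t => ⟨t.2.1, t.2.2⟩)

theorem arc_ne_top {p : Path x y} (hp : pathLength p ≠ ⊤) (a b : I) : arc p a b ≠ ⊤ :=
  ne_top_of_le_ne_top hp (eVariationOn.mono _ (Set.subset_univ _))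

theorem toReal_arc_add {p : Path x y} (hp : pathLength p ≠ ⊤) {a b c : I} (hab : a ≤ b)
    (hbc : b ≤ c) : (arc p a b).toReal + (arc p b c).toReal = (arc p a c).toReal := by
  rw [← ENNReal.toReal_add (arc_ne_top hp _ _) (arc_ne_top hp _ _), arc_add p hab hbc]

theorem dist_le_arc {p : Path x y} (hp : pathLength p ≠ ⊤) {a b s t : I}
    (hs : s ∈ Set.Icc a b) (ht : t ∈ Set.Icc a b) : dist (p s) (p t) ≤ (arc p a b).toReal := by
  rw [dist_edist]
  exact ENNReal.toReal_mono (arc_ne_top hp a b) (eVariationOn.edist_le (fun t => p t) hs ht)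

theorem pathLength_subpath_le (p : Path x y) {a b : I} (hab : a ≤ b) :
    pathLength (p.subpath a b) ≤ arc p a b := by
  refine eVariationOn.comp_le_of_monotoneOn (fun t => p t) (Set.Icc.convexComb a b)
    (fun s _ t _ hst => ?_) fun s _ => ⟨Set.Icc.le_convexComb hab s, Set.Icc.convexComb_le hab s⟩
  change (Set.Icc.convexComb a b s : ℝ) ≤ Set.Icc.convexComb a b t
  rw [Set.Icc.coe_convexComb, Set.Icc.coe_convexComb]
  nlinarith [show (a : ℝ) ≤ b from hab, show (s : ℝ) ≤ t from hst]

theorem pathLength_symm_eq (p : Path x y) : pathLength p.symm = pathLength p :=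
  le_antisymm (pathLength_symm p) (by simpa using pathLength_symm p.symm)

theorem pathLength_refl (x : X) : pathLength (Path.refl x) = 0 := by
  simp [pathLength, eVariationOn]

theorem arc_le_pathLength_of_eqOn (p : Path x y) {x' y' : X} (q : Path x' y') {a b : I} {f : I → ℝ}
    (hf : Monotone f)
    (h : Set.EqOn q (fun t => p (Set.projIcc 0 1 zero_le_one (f t))) (Set.Icc a b)) :
    arc q a b ≤ pathLength p := by
  rw [arc, eVariationOn.eq_of_eqOn h]
  exact eVariationOn.comp_le_of_monotoneOn (fun t => p t) _
    (((Set.monotone_projIcc _).comp hf).monotoneOn _) (Set.mapsTo_univ _ _)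

theorem pathLength_trans_le (p : Path x y) (q : Path y z) :
    pathLength (p.trans q) ≤ pathLength p + pathLength q := by
  let h : I := ⟨1 / 2, by norm_num, by norm_num⟩
  rw [← arc_zero_one, ← arc_add (p.trans q) (b := h) h.2.1 h.2.2]
  refine add_le_add
    (arc_le_pathLength_of_eqOn p _ (f := fun t => 2 * (t : ℝ)) (fun a b hab => ?_)
      fun t ht => if_pos ht.2)
    (arc_le_pathLength_of_eqOn q _ (f := fun t => 2 * (t : ℝ) - 1) (fun a b hab => ?_)
      fun t ht => ?_)
  · linarith [show (a : ℝ) ≤ b from hab]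
  · linarith [show (a : ℝ) ≤ b from hab]
  · rcases ht.1.eq_or_lt with rfl | hlt
    · simp [h, Path.trans_apply]
    · exact if_neg hlt.not_ge

theorem eventually_arc_lt {p : Path x y} (hp : pathLength p ≠ ⊤) (t : I) {ε : ENNReal}
    (hε : 0 < ε) : ∀ᶠ s in 𝓝 t, arc p s t < ε ∧ arc p t s < ε := by
  have hb : BoundedVariationOn (fun t => p t) Set.univ := hp
  have hc : Continuous fun t => p t := p.continuous
  have hleft := hb.tendsto_eVariationOn_Icc_zero_left (x := t) hc.continuousWithinAt
  have hright := hb.tendsto_eVariationOn_Icc_zero_right t hc.continuousWithinAt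
  simp only [Set.univ_inter, nhdsWithin_univ] at hleft hright
  exact (hleft.eventually_lt_const hε).and (hright.eventually_lt_const hε)

theorem exists_nhds_arc_lt {p : Path x y} (hp : pathLength p ≠ ⊤) (t : I) {ε : ENNReal}
    (hε : 0 < ε) : ∃ N ∈ 𝓝 t, ∀ a ∈ N, ∀ b ∈ N, arc p a b < ε := by
  refine ⟨_, eventually_arc_lt hp t (ENNReal.half_pos hε.ne'), fun a ha b hb => ?_⟩
  have hmin : arc p (min a t) t < ε / 2 := by
    rcases le_total a t with h | h
    · simpa [h] using ha.1
    · simpa [h, arc_self] using hε.ne'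
  have hmax : arc p t (max b t) < ε / 2 := by
    rcases le_total b t with h | h
    · simpa [h, arc_self] using hε.ne'
    · simpa [h] using hb.2
  calc arc p a b ≤ arc p (min a t) (max b t) := arc_mono p (min_le_left _ _) (le_max_left _ _)
    _ = arc p (min a t) t + arc p t (max b t) :=
      (arc_add p (min_le_right _ _) (le_max_right _ _)).symm
    _ < ε / 2 + ε / 2 := ENNReal.add_lt_add hmin hmax
    _ = ε := ENNReal.add_halves ε

theorem continuous_arc {p : Path x y} (hp : pathLength p ≠ ⊤) :
    Continuous fun t => (arc p 0 t).toReal := by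
  rw [Metric.continuous_iff']
  intro t ε hε
  filter_upwards [eventually_arc_lt hp t (ENNReal.ofReal_pos.2 hε)] with s hs
  have hst := (ENNReal.lt_ofReal_iff_toReal_lt (arc_ne_top hp s t)).1 hs.1
  have hts := (ENNReal.lt_ofReal_iff_toReal_lt (arc_ne_top hp t s)).1 hs.2
  rw [Real.dist_eq, abs_lt]
  rcases le_total s t with h | h
  · have hadd := toReal_arc_add hp unitInterval.nonneg' h
    constructor <;> linarith [(arc p s t).toReal_nonneg]
  · have hadd := toReal_arc_add hp unitInterval.nonneg' h
    constructor <;> linarith [(arc p t s).toReal_nonneg]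

theorem exists_arc_eq {p : Path x y} (hp : pathLength p ≠ ⊤) {a b : I} (hab : a ≤ b) {c : ℝ}
    (h0 : 0 ≤ c) (hc : c ≤ (arc p a b).toReal) : ∃ t, a ≤ t ∧ t ≤ b ∧
      (arc p a t).toReal = c ∧ (arc p t b).toReal = (arc p a b).toReal - c := by
  have hb := toReal_arc_add hp unitInterval.nonneg' hab
  obtain ⟨t, ht, htc⟩ := isPreconnected_Icc.intermediate_value (Set.left_mem_Icc.2 hab)
    (Set.right_mem_Icc.2 hab) (continuous_arc hp).continuousOn
    (show (arc p 0 a).toReal + c ∈ _ from ⟨by linarith, by linarith⟩)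
  simp only at htc
  have hat := toReal_arc_add hp unitInterval.nonneg' ht.1
  have htb := toReal_arc_add hp ht.1 ht.2
  exact ⟨t, ht.1, ht.2, by linarith, by linarith⟩

theorem eq_refl_of_pathLength_eq_zero (p : Path x x) (hp : pathLength p = 0) :
    p = Path.refl x := by
  ext t
  have h : edist (p t) (p 0) ≤ pathLength p :=
    eVariationOn.edist_le (fun t => p t) (Set.mem_univ t) (Set.mem_univ (0 : I))
  rw [hp] at h
  simpa using h

theorem exists_forall_dist_le_half_arc {p : Path x y} (hp : pathLength p ≠ ⊤) {a b : I}
    (hab : a ≤ b) : ∃ m, ∀ t ∈ Set.Icc a b, dist (p t) (p m) ≤ (arc p a b).toReal / 2 := by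
  have h0 := (arc p a b).toReal_nonneg
  obtain ⟨m, ham, hmb, hleft, hright⟩ := exists_arc_eq hp hab
    (c := (arc p a b).toReal / 2) (by linarith) (by linarith)
  refine ⟨m, fun t ht => ?_⟩
  rcases le_total t m with htm | hmt
  · exact (dist_le_arc hp ⟨ht.1, htm⟩ ⟨ham, le_rfl⟩).trans hleft.le
  · linarith [dist_le_arc hp (Set.mem_Icc.2 ⟨hmt, ht.2⟩) (Set.mem_Icc.2 ⟨le_rfl, hmb⟩)]

theorem pathLength_ne_top_of_eq_edist {p : Path x y} (hp : pathLength p = edist x y) :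
    pathLength p ≠ ⊤ :=
  hp ▸ edist_ne_top x y

theorem toReal_arc_of_eq_edist {p : Path x y} (hp : pathLength p = edist x y) :
    (arc p 0 1).toReal = dist x y := by
  rw [arc_zero_one, hp, dist_edist]

end Arcs

/-! ### Tight complexes -/

/-- Any three points of `S` span a simplex of `K`. -/
def Small {V : Type u} (K : AbstractSimplicialComplex V) (S : Set V) : Prop :=
  ∀ a ∈ S, ∀ b ∈ S, ∀ c ∈ S, Spans K a b c

/-- The common properties of the open Rips complex at scale `L / 3` and the open Čech complex at
scale `L / 4`, with `ρ` a radius below which balls are small. Loops of length less than `L` break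
into three small arcs spanning a simplex; conversely a simplex bounds geodesic triangles that are
filled, through a point `z`, by three loops of length less than `L`. -/
structure IsTight {X : Type u} [MetricSpace X] (K : AbstractSimplicialComplex X)
    (L ρ : ℝ) : Prop where
  pos : 0 < ρ
  two_mul_lt : 2 * ρ < L
  small_ball : ∀ u, Small K (Metric.ball u ρ)
  triangle : ∀ u v w, Spans K u v w → ∃ z, dist z u + dist u v + dist z v < L ∧
    dist z v + dist v w + dist z w < L ∧ dist z u + dist u w + dist z w < L
  small_geodesic : ∀ v w, Spans K v w w → ∀ p : Path v w, pathLength p = edist v w →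
    Small K (Set.range p)
  loop : ∀ (y : X) (β : Path y y), pathLength β < ENNReal.ofReal L → ∃ s t,
    Small K (Set.range (β.subpath 0 s)) ∧ Small K (Set.range (β.subpath s t)) ∧
      Small K (Set.range (β.subpath t 1)) ∧ Spans K (β 0) (β s) (β t)

section Tight

variable {X : Type u} [MetricSpace X]

theorem IsTight.spans_of_mem_balls {K : AbstractSimplicialComplex X} {L ρ : ℝ}
    (h : IsTight K L ρ) {u v w y : X} (hu : y ∈ Metric.ball u ρ) (hv : y ∈ Metric.ball v ρ)
    (hw : y ∈ Metric.ball w ρ) : Spans K u v w :=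
  h.small_ball y u (Metric.mem_ball_comm.1 hu) v (Metric.mem_ball_comm.1 hv) w
    (Metric.mem_ball_comm.1 hw)

theorem spans_rips {r : Scale} {u v w : X} (huv : dist u v < r.1) (hvw : dist v w < r.1)
    (huw : dist u w < r.1) : Spans (rips X r) u v w := by
  classical
  refine ⟨{u, v, w}, ⟨by simp, ?_⟩, by simp, by simp, by simp⟩
  refine (Metric.diam_le_of_forall_dist_le (C := max (dist u v) (max (dist v w) (dist u w)))
    (le_max_of_le_left dist_nonneg) fun a ha b hb => ?_).trans_lt (max_lt huv (max_lt hvw huw))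
  simp only [Finset.coe_insert, Finset.coe_singleton, Set.mem_insert_iff,
    Set.mem_singleton_iff] at ha hb
  rcases ha with rfl | rfl | rfl <;> rcases hb with rfl | rfl | rfl <;> simp [dist_comm]

theorem dist_lt_of_mem_rips {r : Scale} {s : Finset X} (hs : s ∈ (rips X r).faces) {u v : X}
    (hu : u ∈ s) (hv : v ∈ s) : dist u v < r.1 :=
  (Metric.dist_le_diam_of_mem (Finset.finite_toSet s).isBounded hu hv).trans_lt hs.2

theorem small_rips {r : Scale} {S : Set X} (h : ∀ a ∈ S, ∀ b ∈ S, dist a b < r.1) :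
    Small (rips X r) S :=
  fun a ha b hb c hc => spans_rips (h a ha b hb) (h b hb c hc) (h a ha c hc)

theorem small_rips_range_subpath {r : Scale} {x y : X} {p : Path x y} (hp : pathLength p ≠ ⊤)
    {a b : I} (hab : a ≤ b) (h : (arc p a b).toReal < r.1) :
    Small (rips X r) (Set.range (p.subpath a b)) := by
  rw [Path.range_subpath_of_le _ _ _ hab]
  refine small_rips ?_
  rintro _ ⟨c, hc, rfl⟩ _ ⟨d, hd, rfl⟩
  exact (dist_le_arc hp hc hd).trans_lt h

theorem exists_small_rips_arcs {r : Scale} {y : X} {β : Path y y}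
    (hβ : pathLength β < ENNReal.ofReal (3 * r.1)) : ∃ s t,
      Small (rips X r) (Set.range (β.subpath 0 s)) ∧ Small (rips X r) (Set.range (β.subpath s t)) ∧
        Small (rips X r) (Set.range (β.subpath t 1)) ∧ Spans (rips X r) (β 0) (β s) (β t) := by
  have hfin := hβ.ne_top
  have hlt : (arc β 0 1).toReal < 3 * r.1 := by
    rw [arc_zero_one]
    exact (ENNReal.lt_ofReal_iff_toReal_lt hfin).1 hβ
  have hnonneg := (arc β 0 1).toReal_nonneg
  obtain ⟨s, h0s, hs1, hs, hs'⟩ := exists_arc_eq hfin (zero_le_one : (0 : I) ≤ 1)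
    (c := (arc β 0 1).toReal / 3) (by linarith) (by linarith)
  obtain ⟨t, hst, ht1, ht, ht'⟩ := exists_arc_eq hfin hs1
    (c := (arc β 0 1).toReal / 3) (by linarith) (by linarith)
  have d0s := dist_le_arc hfin (Set.left_mem_Icc.2 h0s) (Set.right_mem_Icc.2 h0s)
  have dst := dist_le_arc hfin (Set.left_mem_Icc.2 hst) (Set.right_mem_Icc.2 hst)
  have dt1 := dist_le_arc hfin (Set.left_mem_Icc.2 ht1) (Set.right_mem_Icc.2 ht1)
  rw [β.target.trans β.source.symm, dist_comm] at dt1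
  exact ⟨s, t, small_rips_range_subpath hfin h0s (by linarith),
    small_rips_range_subpath hfin hst (by linarith),
    small_rips_range_subpath hfin ht1 (by linarith),
    spans_rips (by linarith) (by linarith) (by linarith)⟩

theorem isTight_rips (r : Scale) : IsTight (rips X r) (3 * r.1) (r.1 / 2) where
  pos := half_pos r.2
  two_mul_lt := by linarith [r.2]
  small_ball u := small_rips fun a ha b hb => by
    rw [Metric.mem_ball] at ha hb
    linarith [dist_triangle_right a b u]
  triangle := by
    rintro u v w ⟨s, hs, hu, hv, hw⟩
    have huv := dist_lt_of_mem_rips hs hu hv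
    have hvw := dist_lt_of_mem_rips hs hv hw
    have huw := dist_lt_of_mem_rips hs hu hw
    have hr := r.2
    exact ⟨u, by rw [dist_self]; linarith, by linarith, by rw [dist_self]; linarith⟩
  small_geodesic := by
    rintro v w ⟨s, hs, hv, hw, -⟩ p hp
    refine small_rips ?_
    rintro _ ⟨a, rfl⟩ _ ⟨b, rfl⟩
    calc dist (p a) (p b) ≤ (arc p 0 1).toReal :=
        dist_le_arc (pathLength_ne_top_of_eq_edist hp) ⟨a.2.1, a.2.2⟩ ⟨b.2.1, b.2.2⟩
      _ = dist v w := toReal_arc_of_eq_edist hp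
      _ < r.1 := dist_lt_of_mem_rips hs hv hw
  loop _ _ := exists_small_rips_arcs

theorem spans_cech {r : Scale} {u v w z : X} (hu : dist u z < r.1) (hv : dist v z < r.1)
    (hw : dist w z < r.1) : Spans (cech X r) u v w := by
  classical
  refine ⟨{u, v, w}, ⟨by simp, z, ?_⟩, by simp, by simp, by simp⟩
  simp only [Finset.mem_insert, Finset.mem_singleton, Set.mem_iInter, Metric.mem_ball]
  rintro _ (rfl | rfl | rfl) <;> rwa [dist_comm]

theorem exists_forall_dist_lt_of_mem_cech {r : Scale} {s : Finset X} (hs : s ∈ (cech X r).faces) :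
    ∃ z, ∀ u ∈ s, dist u z < r.1 := by
  obtain ⟨z, hz⟩ := hs.2
  simp only [Set.mem_iInter, Metric.mem_ball] at hz
  exact ⟨z, fun u hu => by rw [dist_comm]; exact hz u hu⟩

theorem small_cech {r : Scale} {S : Set X} (z : X) (h : ∀ a ∈ S, dist a z < r.1) :
    Small (cech X r) S :=
  fun a ha b hb c hc => spans_cech (h a ha) (h b hb) (h c hc)

theorem small_cech_range_subpath {r : Scale} {x y : X} {p : Path x y} (hp : pathLength p ≠ ⊤)
    {a b : I} (hab : a ≤ b) (h : (arc p a b).toReal < 2 * r.1) :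
    Small (cech X r) (Set.range (p.subpath a b)) := by
  obtain ⟨m, hm⟩ := exists_forall_dist_le_half_arc hp hab
  rw [Path.range_subpath_of_le _ _ _ hab]
  refine small_cech (p m) ?_
  rintro _ ⟨c, hc, rfl⟩
  linarith [hm c hc]

theorem exists_small_cech_arcs {r : Scale} {y : X} {β : Path y y}
    (hβ : pathLength β < ENNReal.ofReal (4 * r.1)) : ∃ s t,
      Small (cech X r) (Set.range (β.subpath 0 s)) ∧ Small (cech X r) (Set.range (β.subpath s t)) ∧
        Small (cech X r) (Set.range (β.subpath t 1)) ∧ Spans (cech X r) (β 0) (β s) (β t) := by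
  have hfin := hβ.ne_top
  have hlt : (arc β 0 1).toReal < 4 * r.1 := by
    rw [arc_zero_one]
    exact (ENNReal.lt_ofReal_iff_toReal_lt hfin).1 hβ
  have hnonneg := (arc β 0 1).toReal_nonneg
  obtain ⟨s, h0s, hs1, hs, hs'⟩ := exists_arc_eq hfin (zero_le_one : (0 : I) ≤ 1)
    (c := (arc β 0 1).toReal / 2) (by linarith) (by linarith)
  have hsmall := small_cech_range_subpath (r := r) hfin h0s (by linarith)
  refine ⟨s, s, hsmall, small_cech_range_subpath hfin le_rfl ?_,
    small_cech_range_subpath hfin hs1 (by linarith),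
    hsmall _ ⟨0, by simp⟩ _ ⟨1, by simp⟩ _ ⟨1, by simp⟩⟩
  simpa [arc_self] using r.2

theorem isTight_cech (r : Scale) : IsTight (cech X r) (4 * r.1) r.1 where
  pos := r.2
  two_mul_lt := by linarith [r.2]
  small_ball u := small_cech u fun _ ha => ha
  triangle := by
    rintro u v w ⟨s, hs, hu, hv, hw⟩
    obtain ⟨z, hz⟩ := exists_forall_dist_lt_of_mem_cech hs
    have huz := hz u hu
    have hvz := hz v hv
    have hwz := hz w hw
    refine ⟨z, ?_, ?_, ?_⟩ <;> simp only [dist_comm z]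
    · linarith [dist_triangle_right u v z]
    · linarith [dist_triangle_right v w z]
    · linarith [dist_triangle_right u w z]
  small_geodesic := by
    rintro v w ⟨s, hs, hv, hw, -⟩ p hp
    obtain ⟨z, hz⟩ := exists_forall_dist_lt_of_mem_cech hs
    obtain ⟨m, hm⟩ := exists_forall_dist_le_half_arc (pathLength_ne_top_of_eq_edist hp)
      (zero_le_one : (0 : I) ≤ 1)
    rw [toReal_arc_of_eq_edist hp] at hm
    refine small_cech (p m) ?_
    rintro _ ⟨a, rfl⟩
    linarith [hm a a.2, dist_triangle_right v w z, hz v hv, hz w hw]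
  loop _ _ := exists_small_cech_arcs

end Tight

/-! ### Rectifiable paths modulo short loops -/

section PathClass

variable {X : Type u} [MetricSpace X]

/-- A chosen geodesic between two points. -/
def geod (hX : IsGeodesicSpace X) (v w : X) : Path v w :=
  (hX v w).choose

theorem pathLength_geod (hX : IsGeodesicSpace X) (v w : X) :
    pathLength (geod hX v w) = edist v w :=
  (hX v w).choose_spec

theorem geod_self (hX : IsGeodesicSpace X) (v : X) : geod hX v v = Path.refl v :=
  eq_refl_of_pathLength_eq_zero _ (by rw [pathLength_geod, edist_self])

/-- A homotopy class of paths that contains a rectifiable path. -/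
def IsRectifiable {y z : X} (γ : Path.Homotopic.Quotient y z) : Prop :=
  ∃ p : Path y z, pathLength p ≠ ⊤ ∧ mk p = γ

theorem IsRectifiable.mk {y z : X} {p : Path y z} (hp : pathLength p ≠ ⊤) :
    IsRectifiable (mk p) :=
  ⟨p, hp, rfl⟩

theorem IsRectifiable.trans {x y z : X} {γ : Path.Homotopic.Quotient x y}
    {δ : Path.Homotopic.Quotient y z} (hγ : IsRectifiable γ) (hδ : IsRectifiable δ) :
    IsRectifiable (γ.trans δ) := by
  obtain ⟨p, hp, rfl⟩ := hγ
  obtain ⟨q, hq, rfl⟩ := hδ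
  exact ⟨p.trans q, pathLength_trans_ne_top hp hq, rfl⟩

theorem IsRectifiable.symm {x y : X} {γ : Path.Homotopic.Quotient x y} (hγ : IsRectifiable γ) :
    IsRectifiable γ.symm := by
  obtain ⟨p, hp, rfl⟩ := hγ
  exact ⟨p.symm, by rwa [pathLength_symm_eq], rfl⟩

theorem isRectifiable_geod (hX : IsGeodesicSpace X) (v w : X) : IsRectifiable (mk (geod hX v w)) :=
  IsRectifiable.mk (pathLength_ne_top_of_eq_edist (pathLength_geod hX v w))

theorem isRectifiable_of_mem_finPi {x₀ : X} {c : FundamentalGroup X x₀} (hc : c ∈ finPi X x₀) :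
    IsRectifiable c.toPath := by
  obtain ⟨p, hp, rfl⟩ := finPi_le_rectifiablePi X x₀ hc
  exact ⟨p, hp, rfl⟩

theorem fromPath_mem_finPi {x₀ : X} {γ : Path.Homotopic.Quotient x₀ x₀} (hγ : IsRectifiable γ) :
    FundamentalGroup.fromPath γ ∈ finPi X x₀ := by
  obtain ⟨p, hp, rfl⟩ := hγ
  obtain ⟨n, hn⟩ := ENNReal.exists_nat_gt hp
  refine Subgroup.mem_iSup_of_mem n (Subgroup.subset_closure ⟨x₀, Path.refl x₀, p, ?_, ?_, ?_⟩)
  · simp only [pathLength_refl, ne_eq, ENNReal.zero_ne_top, not_false_eq_true]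
  · rwa [ENNReal.ofReal_natCast]
  · simp [lasso, mk_trans]

variable (hX : IsGeodesicSpace X) (x₀ : X)

/-- The loop obtained from a path by joining its ends to the base point by geodesics. -/
def loopAt {y z : X} (γ : Path.Homotopic.Quotient y z) : FundamentalGroup X x₀ :=
  FundamentalGroup.fromPath (((mk (geod hX x₀ y)).trans γ).trans (mk (geod hX x₀ z)).symm)

theorem loopAt_trans {x y z : X} (γ : Path.Homotopic.Quotient x y)
    (δ : Path.Homotopic.Quotient y z) :
    loopAt hX x₀ (γ.trans δ) = loopAt hX x₀ δ * loopAt hX x₀ γ := by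
  simp only [loopAt, FundamentalGroup.mul_def, trans_assoc]
  rw [← trans_assoc (mk (geod hX x₀ y)).symm, symm_trans, refl_trans]

theorem loopAt_base (γ : Path.Homotopic.Quotient x₀ x₀) :
    loopAt hX x₀ γ = FundamentalGroup.fromPath γ := by
  simp [loopAt, geod_self, refl_symm]

theorem inv_loopAt_mul_loopAt {y z : X} (p q : Path y z) :
    (loopAt hX x₀ (mk p))⁻¹ * loopAt hX x₀ (mk q) = lasso (geod hX x₀ y) (q.trans p.symm) := by
  rw [inv_mul_eq_iff_eq_mul]
  simp only [lasso, loopAt, FundamentalGroup.mul_def, mk_trans, mk_symm, trans_assoc]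
  rw [← trans_assoc (mk (geod hX x₀ y)).symm, symm_trans, refl_trans,
    ← trans_assoc (mk p).symm, symm_trans, refl_trans]

theorem loopAt_mem_finPi {y z : X} {γ : Path.Homotopic.Quotient y z} (hγ : IsRectifiable γ) :
    loopAt hX x₀ γ ∈ finPi X x₀ :=
  fromPath_mem_finPi (((isRectifiable_geod hX _ _).trans hγ).trans (isRectifiable_geod hX _ _).symm)

/-- Rectifiable loops modulo loops of length less than `L`. -/
abbrev QuotPi (X : Type u) [MetricSpace X] (x₀ : X) (L : ℝ) : Type u :=
  finPi X x₀ ⧸ (shortPi X x₀ L).subgroupOf (finPi X x₀)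

/-- The class of a rectifiable path in the quotient by the loops of length less than `L`. -/
def pathClass (L : ℝ) {y z : X} {γ : Path.Homotopic.Quotient y z} (hγ : IsRectifiable γ) :
    QuotPi X x₀ L :=
  QuotientGroup.mk ⟨loopAt hX x₀ γ, loopAt_mem_finPi hX x₀ hγ⟩

theorem pathClass_trans (L : ℝ) {x y z : X} {γ : Path.Homotopic.Quotient x y}
    {δ : Path.Homotopic.Quotient y z} (hγ : IsRectifiable γ) (hδ : IsRectifiable δ) :
    pathClass hX x₀ L (hγ.trans hδ) = pathClass hX x₀ L hδ * pathClass hX x₀ L hγ :=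
  congrArg QuotientGroup.mk (Subtype.ext (loopAt_trans hX x₀ γ δ))

theorem pathClass_eq_of_short {L : ℝ} {y z : X} {p q : Path y z} (hp : pathLength p ≠ ⊤)
    (hq : pathLength q ≠ ⊤) (h : pathLength p + pathLength q < ENNReal.ofReal L) :
    pathClass hX x₀ L (.mk hp) = pathClass hX x₀ L (.mk hq) := by
  refine QuotientGroup.eq.2 (Subgroup.mem_subgroupOf.2 (Subgroup.subset_closure
    ⟨y, geod hX x₀ y, q.trans p.symm, pathLength_ne_top_of_eq_edist (pathLength_geod hX _ _), ?_,
      inv_loopAt_mul_loopAt hX x₀ p q⟩))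
  refine (pathLength_trans_le _ _).trans_lt ?_
  rwa [pathLength_symm_eq, add_comm]

/-- The class of a geodesic in the quotient by the loops of length less than `L`. -/
def geodClass (L : ℝ) (v w : X) : QuotPi X x₀ L :=
  pathClass hX x₀ L (isRectifiable_geod hX v w)

theorem geodClass_mul_geodClass {L : ℝ} {u v w : X} (p : Path u w)
    (h : edist u v + edist v w + pathLength p < ENNReal.ofReal L) :
    geodClass hX x₀ L v w * geodClass hX x₀ L u v =
      pathClass hX x₀ L (.mk (ne_top_of_le_ne_top h.ne_top le_add_self)) := by
  rw [geodClass, geodClass, ← pathClass_trans]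
  refine pathClass_eq_of_short hX x₀ (p := (geod hX u v).trans (geod hX v w))
    (pathLength_trans_ne_top ?_ ?_)
    (ne_top_of_le_ne_top h.ne_top le_add_self) ((add_le_add_left ?_ _).trans_lt h)
  · exact pathLength_ne_top_of_eq_edist (pathLength_geod hX _ _)
  · exact pathLength_ne_top_of_eq_edist (pathLength_geod hX _ _)
  · exact (pathLength_trans_le _ _).trans_eq (by rw [pathLength_geod, pathLength_geod])

theorem geodClass_triangle {L : ℝ} {u v w : X} (h : dist u v + dist v w + dist u w < L) :
    geodClass hX x₀ L v w * geodClass hX x₀ L u v = geodClass hX x₀ L u w := by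
  refine geodClass_mul_geodClass hX x₀ (geod hX u w) ?_
  simp only [pathLength_geod, edist_dist]
  rwa [← ENNReal.ofReal_add dist_nonneg dist_nonneg,
    ← ENNReal.ofReal_add (by positivity) dist_nonneg,
    ENNReal.ofReal_lt_ofReal_iff_of_nonneg (by positivity)]

theorem isCocycle_geodClass {K : AbstractSimplicialComplex X} {L ρ : ℝ} (hK : IsTight K L ρ) :
    IsCocycle K (geodClass hX x₀ L) := by
  intro u v w h
  obtain ⟨z, huv, hvw, huw⟩ := hK.triangle u v w h
  rw [← mul_right_cancel_iff (a := geodClass hX x₀ L z u), mul_assoc,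
    geodClass_triangle hX x₀ huv, geodClass_triangle hX x₀ hvw, geodClass_triangle hX x₀ huw]

end PathClass

/-! ### Holonomy along paths in the metric space -/

section BallCocycle

variable {X : Type u} [MetricSpace X] {K : AbstractSimplicialComplex X} {L ρ : ℝ}
  {H : Type*} [Group H] {e : X → X → H}

/-- A cocycle on a tight complex, seen on the cover of the metric space by balls. -/
@[simps]
def IsTight.ballCocycle (hK : IsTight K L ρ) (he : IsCocycle K e) : CoverCocycle X X H where
  patch v := Metric.ball v ρ
  isOpen_patch _ := Metric.isOpen_ball
  exists_mem_patch y := ⟨y, Metric.mem_ball_self hK.pos⟩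
  transition := e
  transition_mul hu hv hw := he _ _ _ (hK.spans_of_mem_balls hu hv hw)

theorem IsTight.mem_ball (hK : IsTight K L ρ) (he : IsCocycle K e) (y : X) :
    y ∈ (hK.ballCocycle he).patch y :=
  Metric.mem_ball_self hK.pos

theorem exists_nhds_forall_range_subpath_subset_ball (hρ : 0 < ρ) {y z : X} (γ : Path y z) (t : I) :
    ∃ N ∈ 𝓝 t, ∀ a b, a ≤ b → Set.Icc a b ⊆ N →
      Set.range (γ.subpath a b) ⊆ Metric.ball (γ t) ρ :=
  ⟨γ ⁻¹' Metric.ball (γ t) ρ,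
    γ.continuous.continuousAt.preimage_mem_nhds (Metric.ball_mem_nhds _ hρ),
    fun _ _ hab hsub => range_subpath_subset γ hab hsub⟩

theorem hol_of_small (hK : IsTight K L ρ) (he : IsCocycle K e) {y z : X} (γ : Path y z)
    (hγ : Small K (Set.range γ)) : (hK.ballCocycle he).hol y z (mk γ) = e y z := by
  have hspans : ∀ a b c : I, Spans K (γ a) (γ b) (γ c) := fun a b c =>
    hγ _ ⟨a, rfl⟩ _ ⟨b, rfl⟩ _ ⟨c, rfl⟩
  refine subpath_induction (P := fun {y z} γ => (hK.ballCocycle he).hol y z γ = e y z) γ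
    (fun a b c _ _ hab hbc => ?_) fun t => ?_
  · rw [(hK.ballCocycle he).hol_trans _ _ (hK.mem_ball he _), hab, hbc, he _ _ _ (hspans a b c)]
  · obtain ⟨N, hN, hball⟩ := exists_nhds_forall_range_subpath_subset_ball hK.pos γ t
    refine ⟨N, hN, fun a b hab hsub => ?_⟩
    rw [(hK.ballCocycle he).hol_of_range_subset (γ t) _ (hball a b hab hsub)
      (hK.mem_ball he _) (hK.mem_ball he _)]
    exact he _ _ _ (hspans a t b)

theorem hol_geod (hX : IsGeodesicSpace X) (hK : IsTight K L ρ) (he : IsCocycle K e) {v w : X}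
    (h : Spans K v w w) : (hK.ballCocycle he).hol v w (mk (geod hX v w)) = e v w :=
  hol_of_small hK he _ (hK.small_geodesic v w h _ (pathLength_geod hX v w))

theorem hol_eq_one_of_short (hK : IsTight K L ρ) (he : IsCocycle K e) {y : X} (β : Path y y)
    (hβ : pathLength β < ENNReal.ofReal L) : (hK.ballCocycle he).hol y y (mk β) = 1 := by
  obtain ⟨s, t, h0s, hst, ht1, hspans⟩ := hK.loop y β hβ
  have hclosed : Spans K (β 0) (β t) (β 1) := by
    obtain ⟨F, hF, h0, -, ht⟩ := hspans
    exact ⟨F, hF, h0, ht, by rwa [β.target, ← β.source]⟩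
  have hsub : (hK.ballCocycle he).hol (β 0) (β 1) (mk (β.subpath 0 1)) = e (β 0) (β 1) := by
    rw [← mk_subpath_trans β 0 t 1, ← mk_subpath_trans β 0 s t,
      (hK.ballCocycle he).hol_trans _ _ (hK.mem_ball he (β t)),
      (hK.ballCocycle he).hol_trans _ _ (hK.mem_ball he (β s)), hol_of_small hK he _ h0s,
      hol_of_small hK he _ hst, hol_of_small hK he _ ht1, he _ _ _ hspans, he _ _ _ hclosed]
  rw [Path.subpath_zero_one] at hsub
  have of_cast : ∀ {y' z' : X} (hy : y' = y) (hz : z' = y),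
      (hK.ballCocycle he).hol y' z' ((mk β).cast hy hz) = e y' z' →
        (hK.ballCocycle he).hol y y (mk β) = e y y := by
    rintro _ _ rfl rfl h
    simpa using h
  exact (of_cast β.source β.target hsub).trans
    ((hK.ballCocycle he).transition_self (hK.mem_ball he y))

end BallCocycle

section GeodesicHolonomy

variable {X : Type u} [MetricSpace X] (hX : IsGeodesicSpace X) (x₀ : X)
  {K : AbstractSimplicialComplex X} {L ρ : ℝ}

theorem hol_geodClass_of_short (hK : IsTight K L ρ) {u y z : X} (γ : Path y z)
    (hγ : Set.range γ ⊆ Metric.ball u ρ) (hlen : pathLength γ < ENNReal.ofReal (L - 2 * ρ)) :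
    (hK.ballCocycle (isCocycle_geodClass hX x₀ hK)).hol y z (mk γ) =
      pathClass hX x₀ L (.mk hlen.ne_top) := by
  have hρ := hK.pos
  have hy : edist y u < ENNReal.ofReal ρ := by
    rw [edist_dist, ENNReal.ofReal_lt_ofReal_iff hρ]
    exact hγ ⟨0, γ.source⟩
  have hz : edist u z < ENNReal.ofReal ρ := by
    rw [edist_dist, ENNReal.ofReal_lt_ofReal_iff hρ, dist_comm]
    exact hγ ⟨1, γ.target⟩
  rw [(hK.ballCocycle _).hol_of_range_subset u γ hγ (hK.mem_ball _ y) (hK.mem_ball _ z)]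
  refine geodClass_mul_geodClass hX x₀ γ ?_
  calc edist y u + edist u z + pathLength γ
      < ENNReal.ofReal ρ + ENNReal.ofReal ρ + ENNReal.ofReal (L - 2 * ρ) :=
        ENNReal.add_lt_add (ENNReal.add_lt_add hy hz) hlen
    _ = ENNReal.ofReal L := by
        rw [← ENNReal.ofReal_add hρ.le hρ.le,
          ← ENNReal.ofReal_add (by linarith) (by linarith [hK.two_mul_lt])]
        congr 1
        ring

theorem hol_geodClass (hK : IsTight K L ρ) {y z : X} {γ : Path.Homotopic.Quotient y z}
    (hγ : IsRectifiable γ) :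
    (hK.ballCocycle (isCocycle_geodClass hX x₀ hK)).hol y z γ = pathClass hX x₀ L hγ := by
  obtain ⟨γ, hγ, rfl⟩ := hγ
  have hsub : ∀ a b : I, a ≤ b → IsRectifiable (mk (γ.subpath a b)) := fun a b hab =>
    .mk (ne_top_of_le_ne_top (arc_ne_top hγ a b) (pathLength_subpath_le γ hab))
  refine subpath_induction (P := fun {y z} γ => ∀ hγ : IsRectifiable γ,
    (hK.ballCocycle (isCocycle_geodClass hX x₀ hK)).hol y z γ = pathClass hX x₀ L hγ) γ
    (fun a b c hab hbc ihab ihbc _ => ?_) (fun t => ?_) _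
  · rw [(hK.ballCocycle _).hol_trans _ _ (hK.mem_ball _ _), ihab (hsub a b hab),
      ihbc (hsub b c hbc), ← pathClass_trans]
  · obtain ⟨N, hN, hshort⟩ := exists_nhds_arc_lt hγ t
      (ENNReal.ofReal_pos.2 (sub_pos.2 hK.two_mul_lt))
    obtain ⟨N', hN', hball⟩ := exists_nhds_forall_range_subpath_subset_ball hK.pos γ t
    refine ⟨N ∩ N', Filter.inter_mem hN hN', fun a b hab hab_sub _ => ?_⟩
    have ⟨hab_N, hab_N'⟩ := Set.subset_inter_iff.1 hab_sub
    exact hol_geodClass_of_short hX x₀ hK _ (hball a b hab hab_N')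
      ((pathLength_subpath_le γ hab).trans_lt
        (hshort a (hab_N ⟨le_rfl, hab⟩) b (hab_N ⟨hab, le_rfl⟩)))

end GeodesicHolonomy

/-! ### The fundamental group of a tight complex -/

section Pi

variable {X : Type u} [MetricSpace X] (hX : IsGeodesicSpace X) (x₀ : X)
  {K : AbstractSimplicialComplex X} {L ρ : ℝ} {H : Type*} [Group H] {e : X → X → H}

include hX in
theorem exists_vertex_paths (hK : IsTight K L ρ) :
    ∃ θ : ∀ v, Path.Homotopic.Quotient (vertex K x₀) (vertex K v),
      θ x₀ = Path.Homotopic.Quotient.refl _ := by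
  have h : ∀ v, Nonempty (Path.Homotopic.Quotient (vertex K x₀) (vertex K v)) := fun v => by
    refine path_induction_on_open_cover (U := fun v : X => Metric.ball v ρ)
      (P := fun {y z} _ => Nonempty (Path.Homotopic.Quotient (vertex K y) (vertex K z)))
      (fun _ => Metric.isOpen_ball) (fun y => ⟨y, Metric.mem_ball_self hK.pos⟩) ?_ ?_
      (mk (geod hX x₀ v))
    · intro u y z γ hγ
      have hy : y ∈ Metric.ball u ρ := hγ ⟨0, γ.source⟩
      have hz : z ∈ Metric.ball u ρ := hγ ⟨1, γ.target⟩
      exact ⟨line (near_vertices (hK.small_ball u _ hy _ hz _ hz))⟩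
    · rintro x y z - - ⟨p⟩ ⟨q⟩
      exact ⟨p.trans q⟩
  exact ⟨fun v => (h x₀).some.symm.trans (h v).some, symm_trans _⟩

theorem shortPi_le_ker_holHom (hK : IsTight K L ρ) (he : IsCocycle K e) :
    shortPi X x₀ L ≤ ((hK.ballCocycle he).holHom (hK.mem_ball he x₀)).ker := by
  refine (Subgroup.closure_le _).2 ?_
  rintro _ ⟨y, α, β, -, hβ, rfl⟩
  set c := hK.ballCocycle he
  change c.hol x₀ x₀ (mk ((α.trans β).trans α.symm)) = 1
  rw [mk_trans, mk_trans, mk_symm, c.hol_trans _ _ (hK.mem_ball he y),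
    c.hol_trans _ _ (hK.mem_ball he y), hol_eq_one_of_short hK he β hβ,
    c.hol_symm _ (hK.mem_ball he x₀) (hK.mem_ball he y), one_mul, inv_mul_cancel]

/-- Holonomy of a cocycle on a tight complex, along loops of the metric space modulo short
loops. -/
def loopHol (hK : IsTight K L ρ) (he : IsCocycle K e) : QuotPi X x₀ L →* H :=
  QuotientGroup.lift _ (((hK.ballCocycle he).holHom (hK.mem_ball he x₀)).comp (finPi X x₀).subtype)
    fun _ hc => shortPi_le_ker_holHom x₀ hK he hc

theorem loopHol_geodClass (hK : IsTight K L ρ) (he : IsCocycle K e) {v w : X}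
    (h : Spans K v w w) : loopHol x₀ hK he (geodClass hX x₀ L v w) =
      ((hK.ballCocycle he).hol x₀ w (mk (geod hX x₀ w)))⁻¹ * e v w *
        (hK.ballCocycle he).hol x₀ v (mk (geod hX x₀ v)) := by
  set c := hK.ballCocycle he
  change c.hol x₀ x₀
    (((mk (geod hX x₀ v)).trans (mk (geod hX v w))).trans (mk (geod hX x₀ w)).symm) = _
  rw [c.hol_trans _ _ (hK.mem_ball he w), c.hol_trans _ _ (hK.mem_ball he v), hol_geod hX hK he h,
    c.hol_symm _ (hK.mem_ball he x₀) (hK.mem_ball he w), mul_assoc]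

/-- The comparison homomorphism from the fundamental group of a tight complex: holonomy of the
cocycle of classes of geodesics. -/
def piHol (hK : IsTight K L ρ) :
    FundamentalGroup (Realization K) (vertex K x₀) →* QuotPi X x₀ L :=
  (starCocycle (isCocycle_geodClass hX x₀ hK)).holHom (vertex_mem_openStar x₀)

theorem loopHol_comp_piHol (hK : IsTight K L ρ) (he : IsCocycle K e) :
    (loopHol x₀ hK he).comp (piHol hX x₀ hK) =
      (starCocycle he).holHom (vertex_mem_openStar x₀) := by
  ext γ
  set c := hK.ballCocycle he
  have hx₀ := hK.mem_ball he x₀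
  refine (CoverCocycle.hol_gauge (c := starCocycle (isCocycle_geodClass hX x₀ hK))
    (c' := starCocycle he) (loopHol x₀ hK he) (fun v => (c.hol x₀ v (mk (geod hX x₀ v)))⁻¹)
    (fun v => subset_rfl) (fun v w y hv hw => ?_) γ.toPath (vertex_mem_openStar x₀)
    (vertex_mem_openStar x₀)).trans ?_
  · rw [inv_inv]
    exact loopHol_geodClass hX x₀ hK he (spans_of_mem_openStar hv hw hw)
  · rw [geod_self, mk_refl, c.hol_refl hx₀ hx₀, c.transition_self hx₀, inv_one, inv_one, one_mul,
      mul_one]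
    rfl

theorem piHol_edgeLoop (hK : IsTight K L ρ)
    (θ : ∀ v, Path.Homotopic.Quotient (vertex K x₀) (vertex K v)) {v w : X} (h : Spans K v w w) :
    piHol hX x₀ hK (edgeLoop θ v w) =
      ((starCocycle (isCocycle_geodClass hX x₀ hK)).hol x₀ w (θ w))⁻¹ * geodClass hX x₀ L v w *
        (starCocycle (isCocycle_geodClass hX x₀ hK)).hol x₀ v (θ v) := by
  set c := starCocycle (isCocycle_geodClass hX x₀ hK)
  rw [edgeLoop_of_spans θ h]
  change c.hol x₀ x₀ _ = _
  rw [c.hol_trans _ _ (vertex_mem_openStar w), c.hol_trans _ _ (vertex_mem_openStar v),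
    hol_line _ h, c.hol_symm _ (vertex_mem_openStar x₀) (vertex_mem_openStar w), mul_assoc]

theorem piHol_comp_loopHol_edgeLoop (hK : IsTight K L ρ)
    (θ : ∀ v, Path.Homotopic.Quotient (vertex K x₀) (vertex K v))
    (hθ : θ x₀ = Path.Homotopic.Quotient.refl _) :
    (piHol hX x₀ hK).comp (loopHol x₀ hK (isCocycle_edgeLoop θ)) = MonoidHom.id _ := by
  ext ⟨γ, hγ⟩
  have hg := isCocycle_geodClass hX x₀ hK
  set s := starCocycle hg
  have hx₀ : vertex K x₀ ∈ s.patch x₀ := vertex_mem_openStar x₀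
  refine (CoverCocycle.hol_gauge (c := hK.ballCocycle (isCocycle_edgeLoop θ))
    (c' := hK.ballCocycle hg) (piHol hX x₀ hK) (fun v => (s.hol x₀ v (θ v))⁻¹)
    (fun v => subset_rfl) (fun v w y hv hw => ?_) γ.toPath (hK.mem_ball _ x₀)
    (hK.mem_ball _ x₀)).trans ?_
  · rw [inv_inv]
    exact piHol_edgeLoop hX x₀ hK θ (hK.spans_of_mem_balls hv hw hw)
  · rw [hθ, s.hol_refl hx₀ hx₀, s.transition_self hx₀, inv_one, inv_one, one_mul, mul_one,
      hol_geodClass hX x₀ hK (isRectifiable_of_mem_finPi hγ)]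
    exact congrArg QuotientGroup.mk (Subtype.ext (loopAt_base hX x₀ _))

theorem piHol_bijective (hK : IsTight K L ρ) : Function.Bijective (piHol hX x₀ hK) := by
  obtain ⟨θ, hθ⟩ := exists_vertex_paths hX x₀ hK
  refine Function.bijective_iff_has_inverse.2 ⟨loopHol x₀ hK (isCocycle_edgeLoop θ),
    fun c => ?_, fun c => DFunLike.congr_fun (piHol_comp_loopHol_edgeLoop hX x₀ hK θ hθ) c⟩
  exact DFunLike.congr_fun ((loopHol_comp_piHol hX x₀ hK _).trans (holHom_edgeLoop θ hθ)) c

theorem piHol_inclusion {K' : AbstractSimplicialComplex X} {L' ρ' : ℝ} (hK : IsTight K L ρ)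
    (hK' : IsTight K' L' ρ') (hKK' : K ≤ K') (hL : L ≤ L')
    (c : FundamentalGroup (Realization K) (vertex K x₀)) :
    piHol hX x₀ hK' (FundamentalGroup.map (inclusion hKK') _ c) =
      QuotientGroup.map _ _ (MonoidHom.id (finPi X x₀))
        (fun _ h => shortPi_mono X x₀ hL h) (piHol hX x₀ hK c) := by
  have h := CoverCocycle.hol_map (c := starCocycle (isCocycle_geodClass hX x₀ hK))
    (c' := starCocycle (isCocycle_geodClass hX x₀ hK')) (inclusion hKK')
    (QuotientGroup.map _ _ (MonoidHom.id (finPi X x₀)) fun _ h => shortPi_mono X x₀ hL h)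
    (fun _ => 1) (fun _ _ hy => hy) (fun v w _ _ _ => by
      rw [inv_one, one_mul, mul_one]
      rfl)
    c.toPath (vertex_mem_openStar x₀) (vertex_mem_openStar x₀)
  rw [inv_one, one_mul, mul_one] at h
  exact h.symm

/-- The natural isomorphism on fundamental groups for a family of tight complexes. -/
def piIso (F : Scale ⥤ AbstractSimplicialComplex X) (a : Scale ⥤ Scale) (ρ : Scale → ℝ)
    (hF : ∀ r, IsTight (F.obj r) (a.obj r).1 (ρ r)) :
    F ⋙ piOne x₀ ≅ a ⋙ quotientPi X x₀ :=
  NatIso.ofComponents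
    (fun r => MulEquiv.toGrpIso (MulEquiv.ofBijective (piHol hX x₀ (hF r))
      (piHol_bijective hX x₀ (hF r))))
    (fun {r s} f => by
      ext c
      exact piHol_inclusion hX x₀ (hF r) (hF s) (F.map f).le (a.map f).le c)

end Pi

/-! ### Chains modulo boundaries of a simplicial set -/

section Opcycles

variable {S : SSet.{u}} {G A : AddCommGrpCat.{u}}

/-- The class of a 1-simplex in the 1-chains modulo boundaries. -/
def edgeClass (G : AddCommGrpCat.{u}) (x : S _⦋1⦌) : G ⟶ (S.chainComplex G).opcycles 1 :=
  S.ιChainComplex x ≫ (S.chainComplex G).pOpcycles 1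

theorem edgeClass_δ (τ : S _⦋2⦌) :
    edgeClass G (S.δ 1 τ) = edgeClass G (S.δ 0 τ) + edgeClass G (S.δ 2 τ) := by
  have h : S.ιChainComplex (R := G) τ ≫ (S.chainComplex G).d 2 1 ≫
      (S.chainComplex G).pOpcycles 1 = 0 := by
    rw [HomologicalComplex.d_pOpcycles, Limits.comp_zero]
  rw [SSet.ιChainComplex_d_assoc, Fin.sum_univ_three] at h
  simp only [Preadditive.add_comp, Preadditive.zsmul_comp] at h
  rw [← sub_eq_zero, ← neg_eq_zero, ← h]
  simp only [edgeClass, Fin.val_zero, Fin.val_one, Fin.val_two, pow_zero, pow_one, even_two,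
    Even.neg_pow, one_pow, one_smul, neg_smul]
  abel

theorem opcycles_hom_ext {f g : (S.chainComplex G).opcycles 1 ⟶ A}
    (h : ∀ x : S _⦋1⦌, edgeClass G x ≫ f = edgeClass G x ≫ g) : f = g := by
  rw [← cancel_epi ((S.chainComplex G).pOpcycles 1)]
  refine SSet.chainComplex_hom_ext fun x => ?_
  simpa only [edgeClass, Category.assoc] using h x

/-- The morphism on `n`-chains with prescribed values on the `n`-simplices. -/
def chainDesc (n : ℕ) (f : S _⦋n⦌ → (G ⟶ A)) : (S.chainComplex G).X n ⟶ A :=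
  Limits.Cofan.IsColimit.desc (S.isColimitChainComplexXCofan G n) f

theorem ι_chainDesc {n : ℕ} (f : S _⦋n⦌ → (G ⟶ A)) (x : S _⦋n⦌) :
    S.ιChainComplex x ≫ chainDesc n f = f x :=
  Limits.Cofan.IsColimit.fac (S.isColimitChainComplexXCofan G n) f x

theorem d_chainDesc {f : S _⦋1⦌ → (G ⟶ A)}
    (hf : ∀ τ : S _⦋2⦌, f (S.δ 1 τ) = f (S.δ 0 τ) + f (S.δ 2 τ)) :
    (S.chainComplex G).d 2 1 ≫ chainDesc 1 f = 0 := by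
  refine SSet.chainComplex_hom_ext fun τ => ?_
  rw [SSet.ιChainComplex_d_assoc, Fin.sum_univ_three]
  simp only [Preadditive.add_comp, Preadditive.zsmul_comp, ι_chainDesc, hf τ, Limits.comp_zero]
  simp

/-- The morphism on chains modulo boundaries induced by a function on 1-simplices that is additive
on the boundaries of 2-simplices. -/
def edgeDesc (f : S _⦋1⦌ → (G ⟶ A))
    (hf : ∀ τ : S _⦋2⦌, f (S.δ 1 τ) = f (S.δ 0 τ) + f (S.δ 2 τ)) :
    (S.chainComplex G).opcycles 1 ⟶ A :=
  (S.chainComplex G).descOpcycles (chainDesc 1 f) 2 (ChainComplex.prev ℕ 1) (d_chainDesc hf)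

theorem edgeClass_edgeDesc (f : S _⦋1⦌ → (G ⟶ A))
    (hf : ∀ τ : S _⦋2⦌, f (S.δ 1 τ) = f (S.δ 0 τ) + f (S.δ 2 τ)) (x : S _⦋1⦌) :
    edgeClass G x ≫ edgeDesc f hf = f x := by
  rw [edgeClass, edgeDesc, Category.assoc, HomologicalComplex.p_descOpcycles, ι_chainDesc]

theorem edgeClass_fromOpcycles (x : S _⦋1⦌) :
    edgeClass G x ≫ (S.chainComplex G).fromOpcycles 1 0 =
      S.ιChainComplex (S.δ 0 x) - S.ιChainComplex (S.δ 1 x) := by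
  rw [edgeClass, Category.assoc, HomologicalComplex.p_fromOpcycles, SSet.ιChainComplex_d,
    Fin.sum_univ_two]
  simp only [Fin.val_zero, Fin.val_one, pow_zero, pow_one, one_smul, neg_smul, sub_eq_add_neg]

theorem edgeClass_opcyclesMap {S' : SSet.{u}} (f : S ⟶ S') (x : S _⦋1⦌) :
    edgeClass G x ≫ HomologicalComplex.opcyclesMap (SSet.chainComplexMap f G) 1 =
      edgeClass G (f.app _ x) := by
  rw [edgeClass, Category.assoc, HomologicalComplex.p_opcyclesMap,
    SSet.ι_chainComplexMap_f_assoc, edgeClass]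

/-- The inclusion of the first homology in the 1-chains modulo boundaries. -/
abbrev homologyToOpcycles (S : SSet.{u}) (G : AddCommGrpCat.{u}) :
    S.homology G 1 ⟶ (S.chainComplex G).opcycles 1 :=
  HomologicalComplex.homologyι _ 1

end Opcycles

/-! ### Paths as singular chains -/

section Singular

variable {X : Type u} [TopologicalSpace X] {G A : AddCommGrpCat.{u}}

/-- The point with parameter `t` of the edge from vertex `i` to vertex `j` of the triangle. -/
def edgePoint (i j : Fin 3) (t : I) : stdSimplex ℝ (Fin 3) :=
  stdSimplex.map ![i, j] (stdSimplexHomeomorphUnitInterval.symm t)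

theorem continuous_edgePoint (i j : Fin 3) : Continuous (edgePoint i j) :=
  (stdSimplex.continuous_map _).comp (Homeomorph.continuous _)

theorem edgePoint_apply (i j k : Fin 3) (t : I) :
    edgePoint i j t k = (if i = k then 1 - (t : ℝ) else 0) + (if j = k then (t : ℝ) else 0) := by
  rw [edgePoint, stdSimplex.map_coe]
  simp [FunOnFinite.linearMap_apply_apply, Finset.sum_filter, Fin.sum_univ_two]
  rfl

/-- An edge of the standard triangle, as a path. -/
@[simps]
def edgePath (i j : Fin 3) :
    Path (stdSimplex.vertex i : stdSimplex ℝ (Fin 3)) (stdSimplex.vertex j) where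
  toFun := edgePoint i j
  continuous_toFun := continuous_edgePoint i j
  source' := stdSimplex.ext (funext fun k => by simp [edgePoint_apply, Pi.single_apply, eq_comm])
  target' := stdSimplex.ext (funext fun k => by simp [edgePoint_apply, Pi.single_apply, eq_comm])

/-- A map from the standard triangle, viewed as a singular simplex. -/
def triangleSimplex (F : C(stdSimplex ℝ (Fin 3), X)) : (TopCat.toSSet.obj (TopCat.of X)) _⦋2⦌ :=
  ((TopCat.of X).toSSetObjEquiv (.op ⦋2⦌)).symm F

theorem δ_triangleSimplex (F : C(stdSimplex ℝ (Fin 3), X)) (k : Fin 3) {y z : X} (p : Path y z)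
    (hp : ∀ t, F (edgePoint (k.succAbove 0) (k.succAbove 1) t) = p t) :
    (TopCat.toSSet.obj (TopCat.of X)).δ k (triangleSimplex F) = (pathSimplex p).edge := by
  have vertices : ![k.succAbove 0, k.succAbove 1] = k.succAbove := by
    ext i : 1
    fin_cases i <;> rfl
  apply ((TopCat.of X).toSSetObjEquiv (.op ⦋1⦌)).injective
  ext x
  change F (stdSimplex.map k.succAbove x) = p (stdSimplexHomeomorphUnitInterval x)
  rw [← hp, edgePoint, Homeomorph.symm_apply_apply, vertices]

theorem edgeClass_diagonal (Q : C(I × I, X)) {a b c d e f : X} {p : Path a b} {q : Path c d}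
    {r : Path e f} (hp : ∀ t, Q (t, 0) = p t) (hq : ∀ t, Q (1, t) = q t)
    (hr : ∀ t, Q (t, t) = r t) :
    edgeClass G (pathSimplex r).edge =
      edgeClass G (pathSimplex q).edge + edgeClass G (pathSimplex p).edge := by
  let proj : ℝ → I := Set.projIcc 0 1 zero_le_one
  have hproj : ∀ t : I, proj t = t := Set.projIcc_val zero_le_one
  have hproj_zero : proj 0 = 0 := hproj 0
  have hproj_one : proj 1 = 1 := hproj 1
  have hcont : ∀ k, Continuous fun s : stdSimplex ℝ (Fin 3) => s k := fun k =>
    (continuous_apply k).comp continuous_subtype_val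
  let F : C(stdSimplex ℝ (Fin 3), X) := Q.comp
    ⟨fun s => (proj (s 1 + s 2), proj (s 2)),
      (continuous_projIcc.comp ((hcont 1).add (hcont 2))).prodMk
        (continuous_projIcc.comp (hcont 2))⟩
  have hF : ∀ s, F s = Q (proj (s 1 + s 2), proj (s 2)) := fun _ => rfl
  rw [← δ_triangleSimplex F 2 p fun t => ?_, ← δ_triangleSimplex F 0 q fun t => ?_,
    ← δ_triangleSimplex F 1 r fun t => ?_, edgeClass_δ]
  · change F (edgePoint 0 2 t) = r t
    simp [hF, edgePoint_apply, hproj, hr]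
  · change F (edgePoint 1 2 t) = q t
    simp [hF, edgePoint_apply, hproj, hproj_one, hq]
  · change F (edgePoint 0 1 t) = p t
    simp [hF, edgePoint_apply, hproj, hproj_zero, hp]

theorem edgeClass_refl (y : X) : edgeClass G (pathSimplex (Path.refl y)).edge = 0 := by
  have h := edgeClass_diagonal (G := G) (ContinuousMap.const _ y) (p := Path.refl y)
    (q := Path.refl y) (r := Path.refl y) (fun _ => rfl) (fun _ => rfl) (fun _ => rfl)
  simpa only [left_eq_add] using h

theorem edgeClass_trans {x y z : X} (p : Path x y) (q : Path y z) :
    edgeClass G (pathSimplex (p.trans q)).edge =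
      edgeClass G (pathSimplex q).edge + edgeClass G (pathSimplex p).edge := by
  refine edgeClass_diagonal
    ⟨fun u => (p.trans q).extend ((u.1 + u.2) / 2), by fun_prop⟩ (fun t => ?_) (fun t => ?_)
    fun t => ?_
  · change (p.trans q).extend (((t : ℝ) + 0) / 2) = p t
    rw [Path.extend_trans_of_le_half _ _ (by linarith [t.2.2]), ← p.extend_extends']
    ring_nf
  · change (p.trans q).extend ((1 + (t : ℝ)) / 2) = q t
    rw [Path.extend_trans_of_half_le _ _ (by linarith [t.2.1]), ← q.extend_extends']
    ring_nf
  · change (p.trans q).extend (((t : ℝ) + t) / 2) = (p.trans q) t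
    rw [add_self_div_two, Path.extend_extends']

theorem edgeClass_eq_of_homotopic {y z : X} {p q : Path y z} (h : p.Homotopic q) :
    edgeClass G (pathSimplex p).edge = edgeClass G (pathSimplex q).edge := by
  obtain ⟨H⟩ := h
  let diagonal : Path y z := ⟨⟨fun t => H (t, t), by fun_prop⟩, by simp, by simp⟩
  have hq := edgeClass_diagonal (G := G) H.toContinuousMap (p := .refl y) (q := q) (r := diagonal)
    (fun t => by simp) (fun t => by simp) (fun _ => rfl)
  have hp := edgeClass_diagonal (G := G) (H.toContinuousMap.comp .prodSwap) (p := p) (q := .refl z)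
    (r := diagonal) (fun t => by simp) (fun t => by simp) (fun _ => rfl)
  rw [edgeClass_refl, add_zero] at hq
  rw [edgeClass_refl, zero_add] at hp
  rw [← hp, hq]

/-- The class of a homotopy class of paths in the 1-chains modulo boundaries. -/
def quotClass (G : AddCommGrpCat.{u}) {y z : X} (γ : Path.Homotopic.Quotient y z) :
    G ⟶ ((TopCat.toSSet.obj (TopCat.of X)).chainComplex G).opcycles 1 :=
  Quotient.lift (fun p => edgeClass G (pathSimplex p).edge)
    (fun _ _ h => edgeClass_eq_of_homotopic h) γ

theorem quotClass_refl (y : X) : quotClass G (Path.Homotopic.Quotient.refl y) = 0 :=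
  edgeClass_refl y

theorem quotClass_trans {x y z : X} (γ : Path.Homotopic.Quotient x y)
    (δ : Path.Homotopic.Quotient y z) :
    quotClass G (γ.trans δ) = quotClass G δ + quotClass G γ := by
  rcases γ with ⟨p⟩
  rcases δ with ⟨q⟩
  exact edgeClass_trans p q

theorem quotClass_symm {x y : X} (γ : Path.Homotopic.Quotient x y) :
    quotClass G γ.symm = -quotClass G γ := by
  rw [eq_neg_iff_add_eq_zero, ← quotClass_trans, trans_symm, quotClass_refl]

/-- The path underlying a singular 1-simplex. -/
def simplexPath (x : (TopCat.toSSet.obj (TopCat.of X)) _⦋1⦌) :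
    Path ((TopCat.of X).toSSetObjEquiv (.op ⦋1⦌) x (stdSimplexHomeomorphUnitInterval.symm 0))
      ((TopCat.of X).toSSetObjEquiv (.op ⦋1⦌) x (stdSimplexHomeomorphUnitInterval.symm 1)) where
  toFun t := (TopCat.of X).toSSetObjEquiv (.op ⦋1⦌) x (stdSimplexHomeomorphUnitInterval.symm t)
  continuous_toFun := by fun_prop
  source' := rfl
  target' := rfl

theorem simplexPath_pathSimplex {α : Sort*} (f : ∀ {y z : X}, Path.Homotopic.Quotient y z → α)
    {y z : X} (p : Path y z) : f (mk (simplexPath (pathSimplex p).edge)) = f (mk p) := by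
  have congr_path : ∀ {y' z' : X} (q : Path y' z'), (∀ t, q t = p t) → f (mk q) = f (mk p) := by
    intro y' z' q hq
    obtain rfl : y' = y := by rw [← q.source, hq, p.source]
    obtain rfl : z' = z := by rw [← q.target, hq, p.target]
    rw [Path.ext (funext hq)]
  refine congr_path _ fun t => ?_
  change p (stdSimplexHomeomorphUnitInterval (stdSimplexHomeomorphUnitInterval.symm t)) = p t
  rw [Homeomorph.apply_symm_apply]

theorem exists_triangle_paths (τ : (TopCat.toSSet.obj (TopCat.of X)) _⦋2⦌) :
    ∃ (a b c : X) (p : Path a b) (q : Path b c) (r : Path a c),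
      (TopCat.toSSet.obj (TopCat.of X)).δ 2 τ = (pathSimplex p).edge ∧
      (TopCat.toSSet.obj (TopCat.of X)).δ 0 τ = (pathSimplex q).edge ∧
      (TopCat.toSSet.obj (TopCat.of X)).δ 1 τ = (pathSimplex r).edge ∧
      (mk p).trans (mk q) = mk r := by
  obtain ⟨F, rfl⟩ : ∃ F, triangleSimplex F = τ :=
    ⟨_, ((TopCat.of X).toSSetObjEquiv (.op ⦋2⦌)).symm_apply_apply τ⟩
  have : ContractibleSpace (stdSimplex ℝ (Fin 3)) :=
    (convex_stdSimplex ℝ (Fin 3)).contractibleSpace ⟨_, (stdSimplex.vertex 0).2⟩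
  have boundary : (mk (edgePath 0 1)).trans (mk (edgePath 1 2)) = mk (edgePath 0 2) :=
    Subsingleton.elim _ _
  refine ⟨_, _, _, (edgePath 0 1).map F.continuous, (edgePath 1 2).map F.continuous,
    (edgePath 0 2).map F.continuous, δ_triangleSimplex F 2 _ fun _ => rfl,
    δ_triangleSimplex F 0 _ fun _ => rfl, δ_triangleSimplex F 1 _ fun _ => rfl, ?_⟩
  have h := congrArg (fun γ => γ.map F) boundary
  rwa [map_trans] at h

/-- The morphism on singular chains modulo boundaries induced by an additive function on homotopy
classes of paths. -/
def pathDesc (f : ∀ {y z : X}, Path.Homotopic.Quotient y z → (G ⟶ A))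
    (hf : ∀ {x y z : X} (γ : Path.Homotopic.Quotient x y) (δ : Path.Homotopic.Quotient y z),
      f (γ.trans δ) = f δ + f γ) :
    ((TopCat.toSSet.obj (TopCat.of X)).chainComplex G).opcycles 1 ⟶ A :=
  edgeDesc (fun s => f (mk (simplexPath s))) fun τ => by
    obtain ⟨a, b, c, p, q, r, h₂, h₀, h₁, h⟩ := exists_triangle_paths τ
    rw [h₀, h₁, h₂, simplexPath_pathSimplex f, simplexPath_pathSimplex f,
      simplexPath_pathSimplex f, ← h, hf]

theorem quotClass_pathDesc (f : ∀ {y z : X}, Path.Homotopic.Quotient y z → (G ⟶ A))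
    (hf : ∀ {x y z : X} (γ : Path.Homotopic.Quotient x y) (δ : Path.Homotopic.Quotient y z),
      f (γ.trans δ) = f δ + f γ) {y z : X} (γ : Path.Homotopic.Quotient y z) :
    quotClass G γ ≫ pathDesc f hf = f γ := by
  rcases γ with ⟨p⟩
  exact (edgeClass_edgeDesc _ _ _).trans (simplexPath_pathSimplex f p)

end Singular

/-! ### Classes of loops in singular homology -/

section Hurewicz

variable {X : Type u} [TopologicalSpace X] (G : Type u) [AddCommGroup G]

theorem loopClass_homologyToOpcycles {y : X} (p : Path y y) :
    loopClass G p ≫ homologyToOpcycles _ _ = edgeClass (.of G) (pathSimplex p).edge := by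
  rw [loopClass, Category.assoc, HomologicalComplex.homology_π_ι,
    HomologicalComplex.liftCycles_i_assoc, edgeClass]

/-- The homology class of a homotopy class of loops. -/
def hurewicz {y : X} (γ : Path.Homotopic.Quotient y y) : AddCommGrpCat.of G ⟶ singularHOne X G :=
  Quotient.lift (fun p => loopClass G p) (fun p q h => by
    rw [← cancel_mono (homologyToOpcycles _ _)]
    exact (loopClass_homologyToOpcycles G p).trans
      ((edgeClass_eq_of_homotopic h).trans (loopClass_homologyToOpcycles G q).symm)) γ

theorem hurewicz_homologyToOpcycles {y : X} (γ : Path.Homotopic.Quotient y y) :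
    hurewicz G γ ≫ homologyToOpcycles _ _ = quotClass (.of G) γ := by
  rcases γ with ⟨p⟩
  exact loopClass_homologyToOpcycles G p

theorem hurewicz_refl (y : X) : hurewicz G (Path.Homotopic.Quotient.refl y) = 0 := by
  rw [← cancel_mono (homologyToOpcycles _ _), hurewicz_homologyToOpcycles, quotClass_refl,
    Limits.zero_comp]

theorem hurewicz_trans {y : X} (γ δ : Path.Homotopic.Quotient y y) :
    hurewicz G (γ.trans δ) = hurewicz G δ + hurewicz G γ := by
  rw [← cancel_mono (homologyToOpcycles _ _)]
  simp only [Preadditive.add_comp, hurewicz_homologyToOpcycles, quotClass_trans]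

theorem hurewicz_conj {x y : X} (α : Path.Homotopic.Quotient x y)
    (β : Path.Homotopic.Quotient y y) :
    hurewicz G ((α.trans β).trans α.symm) = hurewicz G β := by
  rw [← cancel_mono (homologyToOpcycles _ _)]
  simp only [hurewicz_homologyToOpcycles, quotClass_trans, quotClass_symm]
  abel

end Hurewicz

section QuotH

variable {X : Type u} [MetricSpace X] (G : Type u) [AddCommGroup G] {L : ℝ}

/-- The homology classes of rectifiable loops modulo those of loops of length less than `L`. -/
abbrev QuotH (X : Type u) [MetricSpace X] (G : Type u) [AddCommGroup G] (L : ℝ) : Type u :=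
  finH X G ⧸ (shortH X G L).addSubgroupOf (finH X G)

theorem hurewicz_mem_shortH {y : X} {β : Path y y} (hβ : pathLength β < ENNReal.ofReal L) (g : G) :
    (hurewicz G (mk β)).hom g ∈ shortH X G L :=
  AddSubgroup.subset_closure ⟨y, β, g, hβ, rfl⟩

theorem hurewicz_mem_finH {y : X} {γ : Path.Homotopic.Quotient y y} (hγ : IsRectifiable γ)
    (g : G) : (hurewicz G γ).hom g ∈ finH X G := by
  obtain ⟨p, hp, rfl⟩ := hγ
  obtain ⟨n, hn⟩ := ENNReal.exists_nat_gt hp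
  exact AddSubgroup.mem_iSup_of_mem n (hurewicz_mem_shortH G (by rwa [ENNReal.ofReal_natCast]) g)

variable (L) in
/-- The class modulo short loops of a rectifiable loop. -/
def hurewiczMod {y : X} {γ : Path.Homotopic.Quotient y y} (hγ : IsRectifiable γ) :
    AddCommGrpCat.of G ⟶ AddCommGrpCat.of (QuotH X G L) :=
  AddCommGrpCat.ofHom ((QuotientAddGroup.mk' _).comp
    ((hurewicz G γ).hom.codRestrict (finH X G) (hurewicz_mem_finH G hγ)))

theorem hurewiczMod_congr {y z : X} {γ : Path.Homotopic.Quotient y y}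
    {δ : Path.Homotopic.Quotient z z} (hγ : IsRectifiable γ) (hδ : IsRectifiable δ)
    (h : hurewicz G γ = hurewicz G δ) : hurewiczMod G L hγ = hurewiczMod G L hδ := by
  ext g
  exact congrArg QuotientAddGroup.mk (Subtype.ext (ConcreteCategory.congr_hom h g))

theorem hurewiczMod_refl {y : X} (hy : IsRectifiable (Path.Homotopic.Quotient.refl y)) :
    hurewiczMod G L hy = 0 := by
  ext g
  exact congrArg QuotientAddGroup.mk
    (Subtype.ext (ConcreteCategory.congr_hom (hurewicz_refl G y) g))

theorem hurewiczMod_trans {y : X} {γ δ : Path.Homotopic.Quotient y y} (hγ : IsRectifiable γ)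
    (hδ : IsRectifiable δ) :
    hurewiczMod G L (hγ.trans hδ) = hurewiczMod G L hδ + hurewiczMod G L hγ := by
  ext g
  exact congrArg QuotientAddGroup.mk
    (Subtype.ext (ConcreteCategory.congr_hom (hurewicz_trans G γ δ) g))

theorem hurewiczMod_eq_zero_of_short {y : X} {β : Path y y}
    (hβ : pathLength β < ENNReal.ofReal L) : hurewiczMod G L (.mk hβ.ne_top) = 0 := by
  ext g
  exact (QuotientAddGroup.eq_zero_iff _).2 (hurewicz_mem_shortH G hβ g)

theorem quotH_hom_ext {A : AddCommGrpCat.{u}} {f g : AddCommGrpCat.of (QuotH X G L) ⟶ A}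
    (h : ∀ {y : X} {γ : Path.Homotopic.Quotient y y} (hγ : IsRectifiable γ),
      hurewiczMod G L hγ ≫ f = hurewiczMod G L hγ ≫ g) : f = g := by
  have generated : finH X G ≤ ((f.hom.eqLocus g.hom).comap (QuotientAddGroup.mk' _)).map
      (finH X G).subtype := by
    refine iSup_le fun n => (AddSubgroup.closure_le _).2 ?_
    rintro _ ⟨y, β, a, hβ, rfl⟩
    have hβ := IsRectifiable.mk hβ.ne_top
    refine ⟨⟨_, hurewicz_mem_finH G hβ a⟩, ?_, rfl⟩
    exact ConcreteCategory.congr_hom (h hβ) a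
  ext ⟨c, hc⟩
  obtain ⟨c, hfg, rfl⟩ := generated hc
  exact hfg

variable (L) in
/-- The Hurewicz homomorphism on rectifiable loops, modulo short loops in homology. -/
def hurewiczFin (x₀ : X) :
    finPi X x₀ →* Multiplicative (AddCommGrpCat.of G ⟶ AddCommGrpCat.of (QuotH X G L)) where
  toFun c := .ofAdd (hurewiczMod G L (isRectifiable_of_mem_finPi c.2))
  map_one' := congrArg Multiplicative.ofAdd
    (hurewiczMod_refl G (isRectifiable_of_mem_finPi (one_mem (finPi X x₀))))
  map_mul' c d := congrArg Multiplicative.ofAdd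
    (hurewiczMod_trans G (isRectifiable_of_mem_finPi d.2) (isRectifiable_of_mem_finPi c.2))

theorem shortPi_le_map_ker_hurewiczFin (x₀ : X) :
    shortPi X x₀ L ≤ (hurewiczFin G L x₀).ker.map (finPi X x₀).subtype := by
  refine (Subgroup.closure_le _).2 ?_
  rintro _ ⟨y, α, β, hα, hβ, rfl⟩
  have hlasso : IsRectifiable (FundamentalGroup.toPath (lasso α β)) :=
    .trans (.trans (.mk hα) (.mk hβ.ne_top)) (IsRectifiable.mk hα).symm
  refine ⟨⟨_, fromPath_mem_finPi hlasso⟩, ?_, rfl⟩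
  exact congrArg Multiplicative.ofAdd
    ((hurewiczMod_congr G hlasso (.mk hβ.ne_top) (hurewicz_conj G (mk α) (mk β))).trans
      (hurewiczMod_eq_zero_of_short G hβ))

variable (L) in
/-- The Hurewicz homomorphism modulo short loops. -/
def hurewiczQuot (x₀ : X) :
    QuotPi X x₀ L →* Multiplicative (AddCommGrpCat.of G ⟶ AddCommGrpCat.of (QuotH X G L)) :=
  QuotientGroup.lift _ (hurewiczFin G L x₀) fun c hc => by
    obtain ⟨d, hd, hdc⟩ := shortPi_le_map_ker_hurewiczFin G x₀ hc
    rwa [← Subtype.ext hdc]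

theorem hurewiczQuot_pathClass_loop (hX : IsGeodesicSpace X) (x₀ : X) {y : X}
    {γ : Path.Homotopic.Quotient y y} (hγ : IsRectifiable γ) :
    hurewiczQuot G L x₀ (pathClass hX x₀ L hγ) = .ofAdd (hurewiczMod G L hγ) :=
  congrArg Multiplicative.ofAdd
    (hurewiczMod_congr G (isRectifiable_of_mem_finPi (loopAt_mem_finPi hX x₀ hγ)) hγ
      (hurewicz_conj G _ γ))

end QuotH

/-! ### Ordered simplices and cocycles -/

section Ordered

variable {V : Type u} {K : AbstractSimplicialComplex V} {G A : AddCommGrpCat.{u}}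

/-- A vertex as an ordered simplex. -/
def orderedVertex (K : AbstractSimplicialComplex V) (v : V) : (orderedSimplices.obj K) _⦋0⦌ :=
  ⟨fun _ => v, {v}, K.singleton_mem v, fun _ => Finset.mem_singleton_self v⟩

/-- An edge as an ordered simplex. -/
def orderedEdge {v w : V} (h : Spans K v w w) : (orderedSimplices.obj K) _⦋1⦌ :=
  ⟨![v, w], h.imp fun s hs => ⟨hs.1, fun i => by
    fin_cases i
    exacts [hs.2.1, hs.2.2.1]⟩⟩

/-- A triangle as an ordered simplex. -/
def orderedTriangle {u v w : V} (h : Spans K u v w) : (orderedSimplices.obj K) _⦋2⦌ :=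
  ⟨![u, v, w], h.imp fun s hs => ⟨hs.1, fun i => by
    fin_cases i
    exacts [hs.2.1, hs.2.2.1, hs.2.2.2]⟩⟩

theorem spans_of_ordered_edge (x : (orderedSimplices.obj K) _⦋1⦌) :
    Spans K (x.1 0) (x.1 1) (x.1 1) :=
  x.2.imp fun _ hs => ⟨hs.1, hs.2 0, hs.2 1, hs.2 1⟩

theorem edgeClass_fromOpcycles_ordered (x : (orderedSimplices.obj K) _⦋1⦌) :
    edgeClass G x ≫ ((orderedSimplices.obj K).chainComplex G).fromOpcycles 1 0 =
      (orderedSimplices.obj K).ιChainComplex (orderedVertex K (x.1 1)) -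
        (orderedSimplices.obj K).ιChainComplex (orderedVertex K (x.1 0)) := by
  have target : (orderedSimplices.obj K).δ 0 x = orderedVertex K (x.1 1) :=
    Subtype.ext (funext fun i => by fin_cases i; rfl)
  have source : (orderedSimplices.obj K).δ 1 x = orderedVertex K (x.1 0) :=
    Subtype.ext (funext fun i => by fin_cases i; rfl)
  rw [edgeClass_fromOpcycles, target, source]

/-- The homomorphism on chains modulo boundaries defined by a cocycle. -/
def cocycleDesc {e : V → V → Multiplicative (G ⟶ A)} (he : IsCocycle K e) :
    ((orderedSimplices.obj K).chainComplex G).opcycles 1 ⟶ A :=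
  edgeDesc (fun x => (e (x.1 0) (x.1 1)).toAdd) fun τ =>
    congrArg Multiplicative.toAdd (he (τ.1 0) (τ.1 1) (τ.1 2)
      (τ.2.imp fun _ hs => ⟨hs.1, hs.2 0, hs.2 1, hs.2 2⟩)).symm

theorem edgeClass_cocycleDesc {e : V → V → Multiplicative (G ⟶ A)} (he : IsCocycle K e)
    (x : (orderedSimplices.obj K) _⦋1⦌) :
    edgeClass G x ≫ cocycleDesc he = (e (x.1 0) (x.1 1)).toAdd :=
  edgeClass_edgeDesc _ _ x

open Classical in
/-- The universal cocycle with values in the homomorphisms from `G`: an edge is sent to its class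
in the chains modulo boundaries, and a pair of vertices not spanning an edge to `1`. -/
def edgeCocycle (K : AbstractSimplicialComplex V) (G : AddCommGrpCat.{u}) (v w : V) :
    Multiplicative (G ⟶ ((orderedSimplices.obj K).chainComplex G).opcycles 1) :=
  if h : Spans K v w w then .ofAdd (edgeClass G (orderedEdge h)) else 1

theorem edgeCocycle_of_spans {v w : V} (h : Spans K v w w) :
    edgeCocycle K G v w = .ofAdd (edgeClass G (orderedEdge h)) :=
  dif_pos h

theorem edgeCocycle_edge (x : (orderedSimplices.obj K) _⦋1⦌) :
    edgeCocycle K G (x.1 0) (x.1 1) = .ofAdd (edgeClass G x) := by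
  have hx : orderedEdge (spans_of_ordered_edge x) = x :=
    Subtype.ext (funext fun i => by fin_cases i <;> rfl)
  rw [edgeCocycle_of_spans (spans_of_ordered_edge x), hx]

theorem isCocycle_edgeCocycle : IsCocycle K (edgeCocycle K G) := fun u v w h => by
  have boundary := congrArg Multiplicative.ofAdd (edgeClass_δ (G := G) (orderedTriangle h))
  rw [ofAdd_add, ← edgeCocycle_edge, ← edgeCocycle_edge, ← edgeCocycle_edge] at boundary
  exact boundary.symm

end Ordered

/-! ### The first homology of a tight complex -/

section HomologyLift

variable {S : SSet.{u}} {G A : AddCommGrpCat.{u}}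

/-- The lift to the first homology of a morphism whose values are cycles modulo boundaries. -/
def homologyLift (t : A ⟶ (S.chainComplex G).opcycles 1)
    (ht : t ≫ (S.chainComplex G).fromOpcycles 1 0 = 0) : A ⟶ S.homology G 1 :=
  (Limits.KernelFork.IsLimit.lift'
    ((S.chainComplex G).homologyIsKernel 1 0 (ChainComplex.next_nat_succ 0)) t ht).1

theorem homologyLift_homologyToOpcycles (t : A ⟶ (S.chainComplex G).opcycles 1)
    (ht : t ≫ (S.chainComplex G).fromOpcycles 1 0 = 0) :
    homologyLift t ht ≫ homologyToOpcycles S G = t :=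
  (Limits.KernelFork.IsLimit.lift'
    ((S.chainComplex G).homologyIsKernel 1 0 (ChainComplex.next_nat_succ 0)) t ht).2

end HomologyLift

section ChainHolonomy

variable {X : Type u} [MetricSpace X] {K : AbstractSimplicialComplex X} {L ρ : ℝ}
  {G A : AddCommGrpCat.{u}} {e : X → X → Multiplicative (G ⟶ A)}

/-- Holonomy of a cocycle with values in an abelian group, on singular chains modulo boundaries. -/
def chainHol (hK : IsTight K L ρ) (he : IsCocycle K e) :
    ((TopCat.toSSet.obj (TopCat.of X)).chainComplex G).opcycles 1 ⟶ A :=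
  pathDesc (fun {y z} γ => ((hK.ballCocycle he).hol y z γ).toAdd) fun γ δ =>
    congrArg Multiplicative.toAdd ((hK.ballCocycle he).hol_trans γ δ (hK.mem_ball he _))

theorem quotClass_chainHol (hK : IsTight K L ρ) (he : IsCocycle K e) {y z : X}
    (γ : Path.Homotopic.Quotient y z) :
    quotClass G γ ≫ chainHol hK he = ((hK.ballCocycle he).hol y z γ).toAdd :=
  quotClass_pathDesc (fun {y z} γ => ((hK.ballCocycle he).hol y z γ).toAdd) (fun γ δ =>
    congrArg Multiplicative.toAdd ((hK.ballCocycle he).hol_trans γ δ (hK.mem_ball he _))) γ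

/-- Postcomposition with a morphism, as a homomorphism of multiplicative groups. -/
def postcomp (G : AddCommGrpCat.{u}) {A B : AddCommGrpCat.{u}} (f : A ⟶ B) :
    Multiplicative (G ⟶ A) →* Multiplicative (G ⟶ B) :=
  AddMonoidHom.toMultiplicative (Preadditive.rightComp G f)

theorem hol_edgeCocycle_comp_cocycleDesc (hK : IsTight K L ρ) (he : IsCocycle K e) {y z : X}
    (γ : Path.Homotopic.Quotient y z) :
    ((hK.ballCocycle (isCocycle_edgeCocycle (G := G))).hol y z γ).toAdd ≫ cocycleDesc he =
      ((hK.ballCocycle he).hol y z γ).toAdd := by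
  refine congrArg Multiplicative.toAdd (CoverCocycle.map_hol (c' := hK.ballCocycle he)
    (postcomp G (cocycleDesc he)) (fun _ => subset_rfl) (fun v w y hv hw => ?_) γ
    (hK.mem_ball _ y) (hK.mem_ball _ z))
  have h := hK.spans_of_mem_balls hv hw hw
  rw [IsTight.ballCocycle_transition, IsTight.ballCocycle_transition, edgeCocycle_of_spans h]
  exact congrArg Multiplicative.ofAdd (edgeClass_cocycleDesc he (orderedEdge h))

theorem hol_edgeCocycle_comp_fromOpcycles (hK : IsTight K L ρ) {y z : X}
    (γ : Path.Homotopic.Quotient y z) :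
    ((hK.ballCocycle (isCocycle_edgeCocycle (G := G))).hol y z γ).toAdd ≫
        ((orderedSimplices.obj K).chainComplex G).fromOpcycles 1 0 =
      (orderedSimplices.obj K).ιChainComplex (orderedVertex K z) -
        (orderedSimplices.obj K).ιChainComplex (orderedVertex K y) := by
  rw [sub_eq_add_neg]
  refine congrArg Multiplicative.toAdd (CoverCocycle.map_hol_of_coboundary
    (postcomp G (((orderedSimplices.obj K).chainComplex G).fromOpcycles 1 0))
    (fun v => .ofAdd ((orderedSimplices.obj K).ιChainComplex (orderedVertex K v)))
    (fun v w y hv hw => ?_) γ (hK.mem_ball _ y) (hK.mem_ball _ z))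
  have h := hK.spans_of_mem_balls hv hw hw
  rw [IsTight.ballCocycle_transition, edgeCocycle_of_spans h]
  exact congrArg Multiplicative.ofAdd
    ((edgeClass_fromOpcycles_ordered (orderedEdge h)).trans (sub_eq_add_neg _ _))

end ChainHolonomy

section Homology

variable {X : Type u} [MetricSpace X] {K : AbstractSimplicialComplex X} {L ρ : ℝ}
  (G : Type u) [AddCommGroup G]

theorem shortH_le_ker (hK : IsTight K L ρ) :
    shortH X G L ≤ (homologyToOpcycles _ (AddCommGrpCat.of G) ≫
      chainHol hK (isCocycle_edgeCocycle (G := AddCommGrpCat.of G))).hom.ker := by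
  refine (AddSubgroup.closure_le _).2 ?_
  rintro _ ⟨y, β, g, hβ, rfl⟩
  have h : hurewicz G (mk β) ≫ homologyToOpcycles _ (AddCommGrpCat.of G) ≫
      chainHol hK (isCocycle_edgeCocycle (G := AddCommGrpCat.of G)) = 0 := by
    rw [← Category.assoc, hurewicz_homologyToOpcycles, quotClass_chainHol,
      hol_eq_one_of_short hK _ β hβ, toAdd_one]
  exact ConcreteCategory.congr_hom h g

/-- Holonomy of the universal cocycle of a tight complex, on homology classes of rectifiable loops
modulo short loops. -/
def quotHol (hK : IsTight K L ρ) : AddCommGrpCat.of (QuotH X G L) ⟶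
    ((orderedSimplices.obj K).chainComplex (AddCommGrpCat.of G)).opcycles 1 :=
  AddCommGrpCat.ofHom (QuotientAddGroup.lift _
    ((homologyToOpcycles _ (AddCommGrpCat.of G) ≫ chainHol hK isCocycle_edgeCocycle).hom.comp
      (finH X G).subtype) fun _ hc => shortH_le_ker G hK hc)

theorem hurewiczMod_quotHol (hK : IsTight K L ρ) {y : X} {γ : Path.Homotopic.Quotient y y}
    (hγ : IsRectifiable γ) :
    hurewiczMod G L hγ ≫ quotHol G hK =
      quotClass (AddCommGrpCat.of G) γ ≫ chainHol hK isCocycle_edgeCocycle := by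
  rw [← hurewicz_homologyToOpcycles, Category.assoc]
  rfl

theorem quotHol_fromOpcycles (hK : IsTight K L ρ) :
    quotHol G hK ≫
      ((orderedSimplices.obj K).chainComplex (AddCommGrpCat.of G)).fromOpcycles 1 0 = 0 := by
  refine quotH_hom_ext G fun {y γ} hγ => ?_
  rw [← Category.assoc, hurewiczMod_quotHol G hK hγ, quotClass_chainHol,
    hol_edgeCocycle_comp_fromOpcycles, sub_self, Limits.comp_zero]

variable (hX : IsGeodesicSpace X) (x₀ : X)

theorem isCocycle_hurewiczQuot (hK : IsTight K L ρ) :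
    IsCocycle K (fun v w => hurewiczQuot G L x₀ (geodClass hX x₀ L v w)) := fun u v w h => by
  rw [← map_mul, isCocycle_geodClass hX x₀ hK u v w h]

theorem hol_hurewiczQuot (hK : IsTight K L ρ) {y : X} {γ : Path.Homotopic.Quotient y y}
    (hγ : IsRectifiable γ) :
    (hK.ballCocycle (isCocycle_hurewiczQuot G hX x₀ hK)).hol y y γ =
      .ofAdd (hurewiczMod G L hγ) := by
  rw [← hurewiczQuot_pathClass_loop G hX x₀ hγ, ← hol_geodClass hX x₀ hK hγ]
  exact (CoverCocycle.map_hol (c := hK.ballCocycle (isCocycle_geodClass hX x₀ hK))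
    (c' := hK.ballCocycle (isCocycle_hurewiczQuot G hX x₀ hK)) (hurewiczQuot G L x₀)
    (fun _ => subset_rfl) (fun _ _ _ _ _ => rfl) γ
    (hK.mem_ball _ y) (hK.mem_ball _ y)).symm

theorem quotHol_cocycleDesc (hK : IsTight K L ρ) :
    quotHol G hK ≫ cocycleDesc (isCocycle_hurewiczQuot G hX x₀ hK) = 𝟙 _ := by
  refine quotH_hom_ext G fun hγ => ?_
  rw [← Category.assoc, hurewiczMod_quotHol, quotClass_chainHol, hol_edgeCocycle_comp_cocycleDesc,
    hol_hurewiczQuot G hX x₀ hK hγ, toAdd_ofAdd, Category.comp_id]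

theorem quotClass_loopAt {y z : X} (γ : Path.Homotopic.Quotient y z) :
    quotClass (AddCommGrpCat.of G) (FundamentalGroup.toPath (loopAt hX x₀ γ)) =
      quotClass (AddCommGrpCat.of G) γ + quotClass (AddCommGrpCat.of G) (mk (geod hX x₀ y)) -
        quotClass (AddCommGrpCat.of G) (mk (geod hX x₀ z)) := by
  change quotClass _ (Path.Homotopic.Quotient.trans (.trans _ _) _) = _
  rw [quotClass_trans, quotClass_trans, quotClass_symm]
  abel

theorem cocycleDesc_quotHol (hK : IsTight K L ρ) :
    cocycleDesc (isCocycle_hurewiczQuot G hX x₀ hK) ≫ quotHol G hK =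
      𝟙 _ - ((orderedSimplices.obj K).chainComplex (AddCommGrpCat.of G)).fromOpcycles 1 0 ≫
        chainDesc 0 fun x => quotClass (AddCommGrpCat.of G) (mk (geod hX x₀ (x.1 0))) ≫
          chainHol hK isCocycle_edgeCocycle := by
  refine opcycles_hom_ext fun x => ?_
  have hloop := loopAt_mem_finPi hX x₀ (isRectifiable_geod hX (x.1 0) (x.1 1))
  have edge : edgeClass (AddCommGrpCat.of G) x ≫ cocycleDesc (isCocycle_hurewiczQuot G hX x₀ hK) =
      hurewiczMod G L (isRectifiable_of_mem_finPi hloop) :=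
    edgeClass_cocycleDesc _ x
  have hol_edge : quotClass (AddCommGrpCat.of G) (mk (geod hX (x.1 0) (x.1 1))) ≫
      chainHol hK isCocycle_edgeCocycle = edgeClass (AddCommGrpCat.of G) x := by
    rw [quotClass_chainHol, hol_geod hX hK _ (spans_of_ordered_edge x), edgeCocycle_edge,
      toAdd_ofAdd]
  rw [← Category.assoc, edge, hurewiczMod_quotHol, quotClass_loopAt, Preadditive.sub_comp,
    Preadditive.add_comp, hol_edge, Preadditive.comp_sub, Category.comp_id, ← Category.assoc,
    edgeClass_fromOpcycles_ordered, Preadditive.sub_comp, ι_chainDesc, ι_chainDesc]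
  simp only [orderedVertex]
  abel

/-- The first homology of a tight complex: the isomorphism is the holonomy of the cocycle of
classes of geodesics, and its inverse the holonomy of the universal cocycle. -/
@[simps]
def homologyIso (hK : IsTight K L ρ) :
    (orderedSimplices.obj K).homology (AddCommGrpCat.of G) 1 ≅ AddCommGrpCat.of (QuotH X G L) where
  hom := homologyToOpcycles _ _ ≫ cocycleDesc (isCocycle_hurewiczQuot G hX x₀ hK)
  inv := homologyLift (quotHol G hK) (quotHol_fromOpcycles G hK)
  hom_inv_id := by
    rw [← cancel_mono (homologyToOpcycles _ _), Category.assoc, Category.assoc,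
      homologyLift_homologyToOpcycles, cocycleDesc_quotHol, Preadditive.comp_sub,
      Category.comp_id, Category.id_comp, HomologicalComplex.homologyι_comp_fromOpcycles_assoc,
      Limits.zero_comp, sub_zero]
  inv_hom_id := by
    rw [← Category.assoc, homologyLift_homologyToOpcycles, quotHol_cocycleDesc]

/-- The quotient map between the quotients by loops shorter than `L` and by loops shorter than
`L'`. -/
def quotHMap {L' : ℝ} (hL : L ≤ L') :
    AddCommGrpCat.of (QuotH X G L) ⟶ AddCommGrpCat.of (QuotH X G L') :=
  AddCommGrpCat.ofHom (QuotientAddGroup.map _ _ (AddMonoidHom.id (finH X G))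
    fun _ h => shortH_mono X G hL h)

theorem homologyIso_naturality {K' : AbstractSimplicialComplex X} {L' ρ' : ℝ}
    (hK : IsTight K L ρ) (hK' : IsTight K' L' ρ') (f : K ⟶ K') (hL : L ≤ L') :
    (hOne X G).map f ≫ (homologyIso G hX x₀ hK').hom =
      (homologyIso G hX x₀ hK).hom ≫ quotHMap G hL := by
  have opcycles_naturality : HomologicalComplex.opcyclesMap
      (SSet.chainComplexMap (orderedSimplices.map f) (AddCommGrpCat.of G)) 1 ≫
        cocycleDesc (isCocycle_hurewiczQuot G hX x₀ hK') =
      cocycleDesc (isCocycle_hurewiczQuot G hX x₀ hK) ≫ quotHMap G hL := by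
    refine opcycles_hom_ext fun x => ?_
    rw [← Category.assoc, edgeClass_opcyclesMap, ← Category.assoc, edgeClass_cocycleDesc,
      edgeClass_cocycleDesc]
    rfl
  rw [homologyIso_hom, homologyIso_hom, Category.assoc, ← opcycles_naturality]
  exact HomologicalComplex.homologyι_naturality_assoc _ _ _

end Homology

theorem isZero_hOne {X : Type u} [IsEmpty X] (G : Type u) [AddCommGroup G]
    (K : AbstractSimplicialComplex X) : Limits.IsZero ((hOne X G).obj K) := by
  have h : Limits.IsZero
      (((orderedSimplices.obj K).chainComplex (AddCommGrpCat.of G)).opcycles 1) :=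
    (Limits.IsZero.iff_id_eq_zero _).2 (opcycles_hom_ext fun x => isEmptyElim (x.1 0))
  have : Limits.IsZero ((orderedSimplices.obj K).homology (AddCommGrpCat.of G) 1) :=
    h.of_mono (homologyToOpcycles _ _)
  exact this

theorem isZero_quotientH {X : Type u} [MetricSpace X] [IsEmpty X] (G : Type u) [AddCommGroup G]
    (r : Scale) : Limits.IsZero ((quotientH X G).obj r) :=
  (Limits.IsZero.iff_id_eq_zero _).2 (quotH_hom_ext G fun {y} => (IsEmpty.false y).elim)

theorem nonempty_hOne_iso {X : Type u} [MetricSpace X] (hX : IsGeodesicSpace X) (G : Type u)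
    [AddCommGroup G] (F : Scale ⥤ AbstractSimplicialComplex X) (a : Scale ⥤ Scale)
    (ρ : Scale → ℝ) (hF : ∀ r, IsTight (F.obj r) (a.obj r).1 (ρ r)) :
    Nonempty (F ⋙ hOne X G ≅ a ⋙ quotientH X G) := by
  rcases isEmpty_or_nonempty X with h | ⟨⟨x₀⟩⟩
  · exact ⟨NatIso.ofComponents
      (fun r => (isZero_hOne G (F.obj r)).iso (isZero_quotientH G (a.obj r)))
      (fun _ => (isZero_hOne G _).eq_of_src _ _)⟩
  · exact ⟨NatIso.ofComponents (fun r => homologyIso G hX x₀ (hF r))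
      (fun {r s} f => homologyIso_naturality G hX x₀ (hF r) (hF s) (F.map f) (a.map f).le)⟩

theorem isTight_cech_scaleBy (X : Type u) [MetricSpace X] (r : Scale) :
    IsTight ((scaleBy 3 three_pos ⋙ cechFiltration X).obj r)
      ((scaleBy 12 (by norm_num)).obj r).1 (3 * r.1) := by
  have scale : ((scaleBy 12 (by norm_num)).obj r).1 = 4 * (3 * r.1) := by
    change 12 * r.1 = _
    ring
  rw [scale]
  exact isTight_cech ((scaleBy 3 three_pos).obj r)

theorem isTight_rips_scaleBy (X : Type u) [MetricSpace X] (r : Scale) :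
    IsTight ((scaleBy 4 four_pos ⋙ ripsFiltration X).obj r)
      ((scaleBy 12 (by norm_num)).obj r).1 (4 * r.1 / 2) := by
  have scale : ((scaleBy 12 (by norm_num)).obj r).1 = 3 * (4 * r.1) := by
    change 12 * r.1 = _
    ring
  rw [scale]
  exact isTight_rips ((scaleBy 4 four_pos).obj r)

end

end RipsCech

theorem mainTheorem9 {X : Type u} [MetricSpace X] (hX : IsGeodesicSpace X) :
    (∀ x₀ : X,
      Nonempty (scaleBy 3 three_pos ⋙ cechFiltration X ⋙ piOne x₀ ≅
        scaleBy 4 four_pos ⋙ ripsFiltration X ⋙ piOne x₀) ∧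
      Nonempty (scaleBy 3 three_pos ⋙ cechFiltration X ⋙ piOne x₀ ≅
        scaleBy 12 (by norm_num) ⋙ quotientPi X x₀) ∧
      Nonempty (scaleBy 4 four_pos ⋙ ripsFiltration X ⋙ piOne x₀ ≅
        scaleBy 12 (by norm_num) ⋙ quotientPi X x₀)) ∧
    (∀ (G : Type u) [AddCommGroup G],
      Nonempty (scaleBy 3 three_pos ⋙ cechFiltration X ⋙ hOne X G ≅
        scaleBy 4 four_pos ⋙ ripsFiltration X ⋙ hOne X G) ∧
      Nonempty (scaleBy 3 three_pos ⋙ cechFiltration X ⋙ hOne X G ≅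
        scaleBy 12 (by norm_num) ⋙ quotientH X G) ∧
      Nonempty (scaleBy 4 four_pos ⋙ ripsFiltration X ⋙ hOne X G ≅
        scaleBy 12 (by norm_num) ⋙ quotientH X G)) := by
  refine ⟨fun x₀ => ?_, fun G _ => ?_⟩
  · have cech := piIso hX x₀ (scaleBy 3 three_pos ⋙ cechFiltration X) (scaleBy 12 (by norm_num)) _
      (isTight_cech_scaleBy X)
    have rips := piIso hX x₀ (scaleBy 4 four_pos ⋙ ripsFiltration X) (scaleBy 12 (by norm_num)) _
      (isTight_rips_scaleBy X)
    exact ⟨⟨cech ≪≫ rips.symm⟩, ⟨cech⟩, ⟨rips⟩⟩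
  · obtain ⟨cech⟩ := nonempty_hOne_iso hX G (scaleBy 3 three_pos ⋙ cechFiltration X)
      (scaleBy 12 (by norm_num)) _ (isTight_cech_scaleBy X)
    obtain ⟨rips⟩ := nonempty_hOne_iso hX G (scaleBy 4 four_pos ⋙ ripsFiltration X)
      (scaleBy 12 (by norm_num)) _ (isTight_rips_scaleBy X)
    exact ⟨⟨cech ≪≫ rips.symm⟩, ⟨cech⟩, ⟨rips⟩⟩
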